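/- **Setting.** Let $V$ be a smooth $(n+1)$-dimensional manifold fibred over $\mathbb R$ by the absolute time $t$, with velocity space $j_1(V)=\{v\in TV:\langle dt,v\rangle=1\}$, and let $\mathcal A$ be a smooth manifold of dimension $n+1+r$, fibred over $V$ by $\pi$ and embedded over $V$ in $j_1(V)$ (the admissible velocities). In fibred coordinates $(t,q^i,z^A)$, $i=1,\dots,n$, $A=1,\dots,r$, the embedding reads $\dot q^i=\psi^i(t,q,z)$. A $C^1$ section $\gamma:[t_0,t_1]\to V$, $t_0<t_1$, is admissible if its first jet is the image of a (unique, continuous) lift $\hat\gamma:[t_0,t_1]\to\mathcal A$. Let $\mathscr L$ be a smooth function on $\mathcal A$ and $\mathcal I[\gamma]=\int_{t_0}^{t_1}\mathscr L(\hat\gamma(t))\,dt$. Let $\gamma$ be admissible, with $\hat\gamma:\ q^i=q^i(t),\ z^A=z^A(t)$ contained in the domain of a fibred chart $(t,q^i,z^A)$ of $\mathcal A$ (over a fibred chart $(t,q^i)$ of $V$). All partial derivatives below are evaluated along $\hat\gamma$, and repeated indices are summed. Suppose that $\gamma$ is a *normal extremal*, i.e. that * there are functions $p_i(t)$ on $[t_0,t_1]$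 with $\frac{dp_i}{dt}+\frac{\partial\psi^k}{\partial q^i}p_k=\frac{\partial\mathscr L}{\partial q^i}$ and $p_i\frac{\partial\psi^i}{\partial z^A}=\frac{\partial\mathscr L}{\partial z^A}$ (Pontryagin equations); * the homogeneous equations $\frac{d\rho_i}{dt}+\frac{\partial\psi^k}{\partial q^i}\rho_k=0$, $\rho_i\frac{\partial\psi^i}{\partial z^A}=0$ have only the solution $\rho=0$ on $[t_0,t_1]$. Put $\mathscr H=p_i\psi^i-\mathscr L$, $$G_{AB}(t)=-\frac{\partial^2\mathscr H}{\partial z^A\partial z^B},\qquad \mathscr L'=\mathscr L-\frac{dp_i}{dt}\,(q^i-q^i(t))-p_i(t)\Big(\psi^i-\frac{dq^i}{dt}\Big)-\mathscr L(\hat\gamma(t)),$$ and denote by $(d^2\mathscr L')_{\hat\gamma}$ the hessian of $\mathscr L'$ along $\hat\gamma$, as a quadratic form in the components $X^i,\Gamma^A$ of the vectors $\hat X=X^i\frac{\partial}{\partial q^i}+\Gamma^A\frac{\partial}{\partial z^A}$. When $G$ is invertible, with inverse $G^{AB}$, put $$h_i{}^A=-G^{AB}\frac{\partial^2\mathscr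 L'}{\partial q^i\partial z^B},\quad \tilde\partial_i=\frac{\partial}{\partial q^i}+h_i{}^A\frac{\partial}{\partial z^A},\quad N_{ij}=\big\langle(d^2\mathscr L')_{\hat\gamma},\tilde\partial_i\otimes\tilde\partial_j\big\rangle,\quad M^{ij}=G^{AB}\frac{\partial\psi^i}{\partial z^A}\frac{\partial\psi^j}{\partial z^B},\quad \tau_k{}^i=-\tilde\partial_k(\psi^i),$$ $$\frac{DK^i{}_j}{Dt}=\frac{dK^i{}_j}{dt}+\tau_k{}^iK^k{}_j-\tau_j{}^kK^i{}_k,\qquad \frac{DE_{ij}}{Dt}=\frac{dE_{ij}}{dt}-\tau_i{}^kE_{kj}-\tau_j{}^kE_{ik}.$$ **Theorem (Sufficient conditions).** Suppose that $G_{AB}(t)$ is positive definite at each $t\in[t_0,t_1]$, and that the linear system $$\frac{DK^i{}_j}{Dt}=M^{ir}E_{rj},\qquad \frac{DE_{ij}}{Dt}=N_{ir}K^r{}_j$$ has a solution on $[t_0,t_1]$ with $\det K\neq0$ and $EK^{-1}$ symmetric everywhere on $[t_0,t_1]$. Then: 1. $\int_{t_0}^{t_1}\langle(d^2\mathscr L')_{\hat\gamma},\hat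 X\otimes\hat X\rangle\,dt>0$ for every continuous $\hat X=(X^i,\Gamma^A)$ on $[t_0,t_1]$, not identically zero, with $X$ differentiable, $\frac{dX^i}{dt}=\frac{\partial\psi^i}{\partial q^k}X^k+\frac{\partial\psi^i}{\partial z^A}\Gamma^A$ and $X(t_0)=X(t_1)=0$ (admissible infinitesimal deformation with fixed end-points). 2. Let $\gamma_\xi$, $|\xi|<\varepsilon$, be any deformation of $\gamma=\gamma_0$ through admissible sections with the same end-points, whose lifts lie in the chart and have coordinates twice differentiable in $\xi$, with first and second $\xi$-derivatives jointly continuous in $(\xi,t)$. Let $\hat X$ be the $\xi$-derivative at $\xi=0$ of the coordinates $(q^i,z^A)$ of the lifts. Then $\xi\mapsto\mathcal I[\gamma_\xi]$ is differentiable near $0$ and twice differentiable at $0$, with $$\frac{d^2\mathcal I[\gamma_\xi]}{d\xi^2}\Big|_{\xi=0}=\int_{t_0}^{t_1}\langle(d^2\mathscr L')_{\hat\gamma},\hat X\otimes\hat X\rangle\,dt,$$ and this is positive if $\hat X$ is not identically zero. 3. $\gamma$ yields a weak local minimum of the action: there is an open neighbourhood $O\subset TV$ of the image of the first jet of $\gamma$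 such that $\mathcal I[\gamma]\le\mathcal I[\gamma']$ for every admissible $C^1$ section $\gamma':[t_0,t_1]\to V$ with the same end-points as $\gamma$ and with first jet taking values in $O$. -/

import Mathlib

open Set Topology Manifold
open scoped ContDiff

noncomputable section

namespace ConstrainedCalculus

/-- Model space of the event space: coordinates `(t, q)`. -/
abbrev EventModel (n : ℕ) : Type := ℝ × (Fin n → ℝ)

/-- Model space of the admissible velocity space: coordinates `(t, q, z)`. -/
abbrev VelModel (n r : ℕ) : Type := ℝ × (Fin n → ℝ) × (Fin r → ℝ)

/-- Pairs `(q, z)`, used for the coordinates of points of `𝒜` at fixed time, and for the components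
`(X, Γ)` of vectors `X^i ∂/∂q^i + Γ^A ∂/∂z^A` tangent to `𝒜` and annihilating `dt`. -/
abbrev QZ (n r : ℕ) : Type := (Fin n → ℝ) × (Fin r → ℝ)

/-- A constrained system: an event space `V` of dimension `n + 1` fibred over the real line by
`time`, a manifold `A` of admissible velocities of dimension `n + 1 + r` fibred over `V` by `proj`,
and an embedding `a ↦ (proj a, vel a)` over `V` of `A` in the velocity space, the first jet bundle
of `time`. The latter is the affine subbundle of `TV` of the vectors `v` with `⟨dt, v⟩ = 1`. -/
structure ConstrainedSystem (n r : ℕ) (V A : Type*)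
    [TopologicalSpace V] [ChartedSpace (EventModel n) V]
    [IsManifold 𝓘(ℝ, EventModel n) ∞ V]
    [TopologicalSpace A] [ChartedSpace (VelModel n r) A]
    [IsManifold 𝓘(ℝ, VelModel n r) ∞ A] where
  /-- the absolute time -/
  time : V → ℝ
  time_smooth : ContMDiff 𝓘(ℝ, EventModel n) 𝓘(ℝ, ℝ) ∞ time
  time_submersion : ∀ x, Function.Surjective (mfderiv 𝓘(ℝ, EventModel n) 𝓘(ℝ, ℝ) time x)
  /-- the projection of the admissible velocities on the event space -/
  proj : A → V
  proj_smooth : ContMDiff 𝓘(ℝ, VelModel n r) 𝓘(ℝ, EventModel n) ∞ proj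
  proj_submersion : ∀ a, Function.Surjective
    (mfderiv 𝓘(ℝ, VelModel n r) 𝓘(ℝ, EventModel n) proj a)
  /-- the velocity represented by a point of `A` -/
  vel : (a : A) → TangentSpace 𝓘(ℝ, EventModel n) (proj a)
  time_vel : ∀ a, mfderiv 𝓘(ℝ, EventModel n) 𝓘(ℝ, ℝ) time (proj a) (vel a) = (1 : ℝ)
  embedding : IsSmoothEmbedding 𝓘(ℝ, VelModel n r) (𝓘(ℝ, EventModel n)).tangent ∞
    (fun a => (⟨proj a, vel a⟩ : TangentBundle 𝓘(ℝ, EventModel n) V))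

variable {n r : ℕ} {V A : Type*}
  [TopologicalSpace V] [ChartedSpace (EventModel n) V] [IsManifold 𝓘(ℝ, EventModel n) ∞ V]
  [TopologicalSpace A] [ChartedSpace (VelModel n r) A] [IsManifold 𝓘(ℝ, VelModel n r) ∞ A]

namespace ConstrainedSystem

variable (S : ConstrainedSystem n r V A)

/-- The embedding of `A` in the velocity space. -/
def jet (a : A) : TangentBundle 𝓘(ℝ, EventModel n) V := ⟨S.proj a, S.vel a⟩

/-- `g` is, over `[t₀, t₁]`, the (continuous) lift of a `C¹` admissible section `γ = proj ∘ g` of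
the event space: the velocity of `γ` at each `t` is the one represented by `g t`. Since `jet` is an
embedding, `g` is determined by `γ`. -/
structure IsAdmissible (t₀ t₁ : ℝ) (g : ℝ → A) : Prop where
  time_eq : ∀ t ∈ Icc t₀ t₁, S.time (S.proj (g t)) = t
  continuousOn : ContinuousOn g (Icc t₀ t₁)
  velocity : ∀ t ∈ Icc t₀ t₁,
    HasMFDerivWithinAt 𝓘(ℝ, ℝ) 𝓘(ℝ, EventModel n) (S.proj ∘ g) (Icc t₀ t₁) t
      ((1 : ℝ →L[ℝ] ℝ).smulRight (S.vel (g t)))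

/-- The action functional, as a function of the lift of the section. -/
def action (L : A → ℝ) (t₀ t₁ : ℝ) (g : ℝ → A) : ℝ := ∫ t in t₀..t₁, L (g t)

/-- The section `γ = proj ∘ g` yields a weak local minimum: its action does not exceed that of
any admissible section with the same end-points which is close to `γ` in the `C¹` topology, i.e.
whose first jet takes values in a suitable neighbourhood of the image of the first jet of `γ`. -/
def IsWeakLocalMin (L : A → ℝ) (t₀ t₁ : ℝ) (g : ℝ → A) : Prop :=
  S.IsAdmissible t₀ t₁ g ∧
    ∃ O : Set (TangentBundle 𝓘(ℝ, EventModel n) V), IsOpen O ∧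
      (∀ t ∈ Icc t₀ t₁, S.jet (g t) ∈ O) ∧
      ∀ g' : ℝ → A, S.IsAdmissible t₀ t₁ g' →
        S.proj (g' t₀) = S.proj (g t₀) → S.proj (g' t₁) = S.proj (g t₁) →
        (∀ t ∈ Icc t₀ t₁, S.jet (g' t) ∈ O) →
        action L t₀ t₁ g ≤ action L t₀ t₁ g'

/-- A local fibred chart `(t, q, z)` of `A` over a local fibred chart `(t, q)` of `V`. -/
structure FibredChart where
  chartV : OpenPartialHomeomorph V (EventModel n)
  chartV_mem : chartV ∈ IsManifold.maximalAtlas 𝓘(ℝ, EventModel n) ∞ V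
  chartV_time : ∀ x ∈ chartV.source, (chartV x).1 = S.time x
  chartA : OpenPartialHomeomorph A (VelModel n r)
  chartA_mem : chartA ∈ IsManifold.maximalAtlas 𝓘(ℝ, VelModel n r) ∞ A
  proj_mem : ∀ a ∈ chartA.source, S.proj a ∈ chartV.source
  chartA_time : ∀ a ∈ chartA.source, (chartA a).1 = (chartV (S.proj a)).1
  chartA_pos : ∀ a ∈ chartA.source, (chartA a).2.1 = (chartV (S.proj a)).2

namespace FibredChart

variable {S} (c : S.FibredChart)

/-- Coordinates `(q(t), z(t))` of the curve `g`. -/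
def coord (g : ℝ → A) (t : ℝ) : QZ n r := (c.chartA (g t)).2

/-- Local expression of the Lagrangian. -/
def lag (L : A → ℝ) (t : ℝ) (y : QZ n r) : ℝ := L (c.chartA.symm (t, y))

/-- Local expression `q̇ = ψ(t, q, z)` of the embedding of `A` in the velocity space. -/
def psi (t : ℝ) (y : QZ n r) : Fin n → ℝ :=
  let a := c.chartA.symm (t, y)
  (mfderiv 𝓘(ℝ, EventModel n) 𝓘(ℝ, EventModel n) c.chartV (S.proj a) (S.vel a) : EventModel n).2

/-- The basis vector `∂/∂q^i`. -/
def dq (r : ℕ) {n : ℕ} (i : Fin n) : QZ n r := (Pi.single i 1, 0)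

/-- The basis vector `∂/∂z^A`. -/
def dz (n : ℕ) {r : ℕ} (α : Fin r) : QZ n r := (0, Pi.single α 1)

/-- The hessian of a function of `(q, z)`, as a bilinear form. -/
def hessian (f : QZ n r → ℝ) (y u v : QZ n r) : ℝ := fderiv ℝ (fun y' => fderiv ℝ f y') y u v

/-- Derivative along `g`, in the direction `u`, of the functions `ψ`; the `i`-th component is
`u(ψ^i)`. -/
def dpsi (g : ℝ → A) (t : ℝ) (u : QZ n r) : Fin n → ℝ := fderiv ℝ (c.psi t) (c.coord g t) u

/-- Derivative of the Lagrangian along `g` in the direction `u`. -/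
def dlag (L : A → ℝ) (g : ℝ → A) (t : ℝ) (u : QZ n r) : ℝ :=
  fderiv ℝ (c.lag L t) (c.coord g t) u

/-- The curve `t ↦ (q(t), z(t), p(t))` is a solution of the Pontryagin equations (the admissibility
equation `dq/dt = ψ` being required of `g`). -/
structure IsPontryagin (L : A → ℝ) (t₀ t₁ : ℝ) (g : ℝ → A) (p : ℝ → Fin n → ℝ) : Prop where
  deriv_p : ∀ t ∈ Icc t₀ t₁, ∀ i, HasDerivWithinAt (fun s => p s i)
    (c.dlag L g t (dq r i) - ∑ k, c.dpsi g t (dq r i) k * p t k) (Icc t₀ t₁) t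
  stationary : ∀ t ∈ Icc t₀ t₁, ∀ α,
    ∑ i, p t i * c.dpsi g t (dz n α) i = c.dlag L g t (dz n α)

/-- `proj ∘ g` is normal: the homogeneous equations `dρ_i/dt + ∂ψ^k/∂q^i ρ_k = 0`,
`ρ_i ∂ψ^i/∂z^A = 0` only have the trivial solution on `[t₀, t₁]`. -/
def IsNormal (t₀ t₁ : ℝ) (g : ℝ → A) : Prop :=
  ∀ ρ : ℝ → Fin n → ℝ,
    (∀ t ∈ Icc t₀ t₁, ∀ i, HasDerivWithinAt (fun s => ρ s i)
      (-∑ k, c.dpsi g t (dq r i) k * ρ t k) (Icc t₀ t₁) t) →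
    (∀ t ∈ Icc t₀ t₁, ∀ α, ∑ i, ρ t i * c.dpsi g t (dz n α) i = 0) →
    ∀ t ∈ Icc t₀ t₁, ρ t = 0

/-- The Pontryagin Hamiltonian `ℋ(t, q, z, p) = p_i ψ^i - ℒ`. -/
def hamiltonian (L : A → ℝ) (t : ℝ) (y : QZ n r) (p : Fin n → ℝ) : ℝ :=
  ∑ i, p i * c.psi t y i - c.lag L t y

/-- The matrix `G_AB = - ∂²ℋ/∂z^A∂z^B` along the extremal. -/
def G (L : A → ℝ) (g : ℝ → A) (p : ℝ → Fin n → ℝ) (t : ℝ) : Matrix (Fin r) (Fin r) ℝ :=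
  Matrix.of fun α β =>
    -hessian (fun y => c.hamiltonian L t y (p t)) (c.coord g t) (dz n α) (dz n β)

/-- The adapted Lagrangian
`ℒ' = ℒ - (dp_i/dt) (q^i - q^i(t)) - p_i(t) (ψ^i - dq^i/dt) - ℒ|_g`. -/
def adaptedLag (L : A → ℝ) (t₀ t₁ : ℝ) (g : ℝ → A) (p : ℝ → Fin n → ℝ) (t : ℝ) (y : QZ n r) : ℝ :=
  c.lag L t y
    - ∑ i, derivWithin (fun s => p s i) (Icc t₀ t₁) t * (y.1 i - (c.coord g t).1 i)
    - ∑ i, p t i * (c.psi t y i - derivWithin (fun s => (c.coord g s).1 i) (Icc t₀ t₁) t)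
    - L (g t)

/-- The hessian `(d²ℒ')` along `g`. -/
def hess (L : A → ℝ) (t₀ t₁ : ℝ) (g : ℝ → A) (p : ℝ → Fin n → ℝ) (t : ℝ) (u v : QZ n r) : ℝ :=
  hessian (c.adaptedLag L t₀ t₁ g p t) (c.coord g t) u v

/-- The infinitesimal control `h_i^A = - G^{AB} ∂²ℒ'/∂q^i∂z^B`. -/
def control (L : A → ℝ) (t₀ t₁ : ℝ) (g : ℝ → A) (p : ℝ → Fin n → ℝ) (t : ℝ) (i : Fin n)
    (α : Fin r) : ℝ :=
  -∑ β, (c.G L g p t)⁻¹ α β * c.hess L t₀ t₁ g p t (dq r i) (dz n β)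

/-- The horizontal vector `∂̃_i = ∂/∂q^i + h_i^A ∂/∂z^A`. -/
def hor (L : A → ℝ) (t₀ t₁ : ℝ) (g : ℝ → A) (p : ℝ → Fin n → ℝ) (t : ℝ) (i : Fin n) : QZ n r :=
  (Pi.single i 1, c.control L t₀ t₁ g p t i)

/-- `N_ij = ⟨d²ℒ', ∂̃_i ⊗ ∂̃_j⟩`. -/
def N (L : A → ℝ) (t₀ t₁ : ℝ) (g : ℝ → A) (p : ℝ → Fin n → ℝ) (t : ℝ) :
    Matrix (Fin n) (Fin n) ℝ :=
  Matrix.of fun i j =>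
    c.hess L t₀ t₁ g p t (c.hor L t₀ t₁ g p t i) (c.hor L t₀ t₁ g p t j)

/-- `M^{ij} = G^{AB} ∂ψ^i/∂z^A ∂ψ^j/∂z^B`. -/
def M (L : A → ℝ) (g : ℝ → A) (p : ℝ → Fin n → ℝ) (t : ℝ) : Matrix (Fin n) (Fin n) ℝ :=
  Matrix.of fun i j =>
    ∑ α, ∑ β, (c.G L g p t)⁻¹ α β * c.dpsi g t (dz n α) i * c.dpsi g t (dz n β) j

/-- The temporal connection coefficients `τ_k^i = - ∂̃_k(ψ^i)`. -/
def tau (L : A → ℝ) (t₀ t₁ : ℝ) (g : ℝ → A) (p : ℝ → Fin n → ℝ) (t : ℝ) (k i : Fin n) : ℝ :=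
  -c.dpsi g t (c.hor L t₀ t₁ g p t k) i

/-- Absolute time derivative of a virtual tensor of type `K^i_j`:
`DK^i_j/Dt = dK^i_j/dt + τ_k^i K^k_j - τ_j^k K^i_k`. -/
def absDerivMixed (L : A → ℝ) (t₀ t₁ : ℝ) (g : ℝ → A) (p : ℝ → Fin n → ℝ)
    (K : ℝ → Matrix (Fin n) (Fin n) ℝ) (t : ℝ) : Matrix (Fin n) (Fin n) ℝ :=
  Matrix.of fun i j =>
    derivWithin (fun s => K s i j) (Icc t₀ t₁) t
      + ∑ k, c.tau L t₀ t₁ g p t k i * K t k j - ∑ k, c.tau L t₀ t₁ g p t j k * K t i k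

/-- Absolute time derivative of a virtual tensor of type `E_ij`:
`DE_ij/Dt = dE_ij/dt - τ_i^k E_kj - τ_j^k E_ik`. -/
def absDerivCov (L : A → ℝ) (t₀ t₁ : ℝ) (g : ℝ → A) (p : ℝ → Fin n → ℝ)
    (E : ℝ → Matrix (Fin n) (Fin n) ℝ) (t : ℝ) : Matrix (Fin n) (Fin n) ℝ :=
  Matrix.of fun i j =>
    derivWithin (fun s => E s i j) (Icc t₀ t₁) t
      - ∑ k, c.tau L t₀ t₁ g p t i k * E t k j - ∑ k, c.tau L t₀ t₁ g p t j k * E t i k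

/-- `(K, E)` is a solution on `[t₀, t₁]` of the linear system `DK/Dt = M E`, `DE/Dt = N K`. -/
structure IsLinearSolution (L : A → ℝ) (t₀ t₁ : ℝ) (g : ℝ → A) (p : ℝ → Fin n → ℝ)
    (K E : ℝ → Matrix (Fin n) (Fin n) ℝ) : Prop where
  differentiable_K : ∀ i j, DifferentiableOn ℝ (fun t => K t i j) (Icc t₀ t₁)
  differentiable_E : ∀ i j, DifferentiableOn ℝ (fun t => E t i j) (Icc t₀ t₁)
  eq_K : ∀ t ∈ Icc t₀ t₁, c.absDerivMixed L t₀ t₁ g p K t = c.M L g p t * E t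
  eq_E : ∀ t ∈ Icc t₀ t₁, c.absDerivCov L t₀ t₁ g p E t = c.N L t₀ t₁ g p t * K t

/-- `X̂ = X^i ∂/∂q^i + Γ^A ∂/∂z^A` is an admissible infinitesimal deformation of `g` (a solution of
the variational equation) with fixed end-points. -/
structure IsInfinitesimalDeformation (t₀ t₁ : ℝ) (g : ℝ → A) (X : ℝ → QZ n r) : Prop where
  continuousOn : ContinuousOn X (Icc t₀ t₁)
  variational : ∀ t ∈ Icc t₀ t₁,
    HasDerivWithinAt (fun s => (X s).1) (c.dpsi g t (X t)) (Icc t₀ t₁) t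
  left : (X t₀).1 = 0
  right : (X t₁).1 = 0

/-- The quadratic form `∫ ⟨d²ℒ', X̂ ⊗ X̂⟩ dt`. -/
def secondVariation (L : A → ℝ) (t₀ t₁ : ℝ) (g : ℝ → A) (p : ℝ → Fin n → ℝ)
    (X : ℝ → QZ n r) : ℝ :=
  ∫ t in t₀..t₁, c.hess L t₀ t₁ g p t (X t) (X t)

/-- `Γ ξ`, for `|ξ| < ε`, are the lifts of an admissible deformation with fixed end-points of
`proj ∘ g`, twice continuously differentiable in `ξ`; `y₁` and `y₂` are the first and second
derivatives with respect to `ξ` of the coordinates `(φ(t, ξ), ζ(t, ξ))` of `Γ ξ t`. In particular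
`y₁ 0` is the infinitesimal deformation tangent to `Γ`. -/
structure IsDeformation (t₀ t₁ : ℝ) (g : ℝ → A) (ε : ℝ) (Γ : ℝ → ℝ → A)
    (y₁ y₂ : ℝ → ℝ → QZ n r) : Prop where
  pos : 0 < ε
  zero : ∀ t ∈ Icc t₀ t₁, Γ 0 t = g t
  admissible : ∀ ξ ∈ Ioo (-ε) ε, S.IsAdmissible t₀ t₁ (Γ ξ)
  left : ∀ ξ ∈ Ioo (-ε) ε, S.proj (Γ ξ t₀) = S.proj (g t₀)
  right : ∀ ξ ∈ Ioo (-ε) ε, S.proj (Γ ξ t₁) = S.proj (g t₁)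
  mem_source : ∀ ξ ∈ Ioo (-ε) ε, ∀ t ∈ Icc t₀ t₁, Γ ξ t ∈ c.chartA.source
  hasDeriv : ∀ ξ ∈ Ioo (-ε) ε, ∀ t ∈ Icc t₀ t₁,
    HasDerivAt (fun η => c.coord (Γ η) t) (y₁ ξ t) ξ
  hasDeriv₂ : ∀ ξ ∈ Ioo (-ε) ε, ∀ t ∈ Icc t₀ t₁, HasDerivAt (fun η => y₁ η t) (y₂ ξ t) ξ
  continuousOn₁ : ContinuousOn (Function.uncurry y₁) (Ioo (-ε) ε ×ˢ Icc t₀ t₁)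
  continuousOn₂ : ContinuousOn (Function.uncurry y₂) (Ioo (-ε) ε ×ˢ Icc t₀ t₁)

end FibredChart

end ConstrainedSystem

end ConstrainedCalculus

end

/-!
The theorem rests on a quadratic calibration of the adapted Lagrangian `ℒ'`.

Along the extremal `ℒ'` vanishes together with its differential (`adaptedLag_coord`,
`adaptedLagFDeriv_coord`), and for admissible sections with the same end-points the difference of
the actions is the integral of `ℒ'`, because the terms in `p` and `dp/dt` subtracted from
`ℒ` add up to the derivative of `p_i (q^i - q^i(t))` (`action_sub_action`). Hence the derivatives of the action along a
deformation are found by differentiating `∫ ℒ'` under the integral sign, and only the hessian of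
`ℒ'` survives in the second one (`IsDeformation.action_derivatives`).

The matrix `W₀ = E K⁻¹` is symmetric and satisfies the Riccati equation `W₀' = N + ᵗT W₀ + W₀ T - W₀
M W₀` (`hasDerivWithinAt_riccati`). Subtracting from the hessian of `ℒ'` the total derivative of
`W₀_ij X^i X^j`, whose integral vanishes when `X` does at the end-points, leaves a perfect square
with matrix `G` (`sub_riccati_eq_dotProduct`), which is only nonnegative, and positive in the
vertical directions `X = 0`. By Finsler's lemma (`exists_pos_add_mul`) the form becomes positive
definite, at all times, when `W₀` is replaced by `W = W₀ - exp (k (t - t₁))` with `k` large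
(`exists_pos_calibratedForm`). This yields at once the positivity of the second variation
(`secondVariation_pos`).

For the weak minimum, let `x` be the difference of the coordinates `q` of a nearby admissible
section and of the extremal. Subtracting from `ℒ'` half the total derivative of `W_ij x^i x^j` gives
a function of `(q, z)` which vanishes to first order on the extremal and whose hessian is positive
definite there. By compactness it is positive definite in a uniform neighbourhood, so the function
is nonnegative in it (`half_total_derivative_le_adaptedLag`), and integration gives the inequality
of the actions. A uniform neighbourhood in coordinates comes from an open set of `TV`, since `A` is
embedded in `TV` (`isWeakLocalMin_of_calibratedForm_pos`).
-/

noncomputable section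

/-! ### Calculus on compact intervals and of matrix functions -/

namespace ConstrainedCalculus

open MeasureTheory intervalIntegral Filter

section Analysis

variable {E F : Type*} [NormedAddCommGroup E] [NormedSpace ℝ E]
  [NormedAddCommGroup F] [NormedSpace ℝ F]

theorem integral_eq_sub_of_hasDerivWithinAt_Icc [CompleteSpace E] {a b : ℝ} (hab : a ≤ b)
    {f f' : ℝ → E} (hf : ∀ t ∈ Icc a b, HasDerivWithinAt f (f' t) (Icc a b) t)
    (hf' : ContinuousOn f' (Icc a b)) : ∫ t in a..b, f' t = f b - f a := by
  refine integral_eq_sub_of_hasDerivAt_of_le hab (fun t ht => (hf t ht).continuousWithinAt)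
    (fun t ht => (hf t (Ioo_subset_Icc_self ht)).hasDerivAt (Icc_mem_nhds ht.1 ht.2)) ?_
  exact ContinuousOn.intervalIntegrable (by rwa [uIcc_of_le hab])

/-- Differentiation under the integral sign over a compact interval. -/
theorem hasDerivAt_integral_of_continuousOn [CompleteSpace E] {a b ε : ℝ} (hab : a ≤ b)
    {f f' : ℝ → ℝ → E} (hf : ∀ ξ ∈ Ioo (-ε) ε, ContinuousOn (f ξ) (Icc a b))
    (hd : ∀ ξ ∈ Ioo (-ε) ε, ∀ t ∈ Icc a b, HasDerivAt (fun η => f η t) (f' ξ t) ξ)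
    (hf' : ContinuousOn (Function.uncurry f') (Ioo (-ε) ε ×ˢ Icc a b))
    {ξ : ℝ} (hξ : ξ ∈ Ioo (-ε) ε) :
    HasDerivAt (fun η => ∫ t in a..b, f η t) (∫ t in a..b, f' ξ t) ξ := by
  obtain ⟨δ, hδ, hball⟩ := Metric.nhds_basis_closedBall.mem_iff.1 (isOpen_Ioo.mem_nhds hξ)
  have hKc : IsCompact (Metric.closedBall ξ δ ×ˢ Icc a b) :=
    (isCompact_closedBall ξ δ).prod isCompact_Icc
  obtain ⟨C, hC⟩ := hKc.exists_bound_of_continuousOn (hf'.mono (prod_mono hball subset_rfl))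
  have hsub : uIoc a b ⊆ Icc a b := by
    rw [uIoc_of_le hab]; exact Ioc_subset_Icc_self
  have hint : ∀ h : ℝ → E, ContinuousOn h (Icc a b) →
      AEStronglyMeasurable h (volume.restrict (uIoc a b)) := fun h hh =>
    (hh.mono hsub).aestronglyMeasurable measurableSet_uIoc
  refine (intervalIntegral.hasDerivAt_integral_of_dominated_loc_of_deriv_le
    (s := Metric.closedBall ξ δ)
    (bound := fun _ => C) (F' := f') (Metric.closedBall_mem_nhds ξ hδ) ?_ ?_ ?_ ?_ ?_ ?_).2
  · filter_upwards [isOpen_Ioo.mem_nhds hξ] with η hη using hint _ (hf η hη)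
  · exact ContinuousOn.intervalIntegrable (by rw [uIcc_of_le hab]; exact hf ξ hξ)
  · exact hint _ (hf'.comp (f := fun t => (ξ, t)) (by fun_prop) fun t ht => ⟨hξ, ht⟩)
  · exact Eventually.of_forall fun t ht η hη => hC (η, t) ⟨hη, hsub ht⟩
  · exact intervalIntegrable_const
  · exact Eventually.of_forall fun t ht η hη => hd η (hball hη) t (hsub ht)

/-- A family of continuous curves is jointly continuous if it has a jointly continuous derivative
with respect to the parameter, since it is then locally Lipschitz in the parameter. -/
theorem continuousOn_uncurry_of_hasDerivAt {a b ε : ℝ}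
    {f f' : ℝ → ℝ → E} (hf : ∀ ξ ∈ Ioo (-ε) ε, ContinuousOn (f ξ) (Icc a b))
    (hd : ∀ ξ ∈ Ioo (-ε) ε, ∀ t ∈ Icc a b, HasDerivAt (fun η => f η t) (f' ξ t) ξ)
    (hf' : ContinuousOn (Function.uncurry f') (Ioo (-ε) ε ×ˢ Icc a b)) :
    ContinuousOn (Function.uncurry f) (Ioo (-ε) ε ×ˢ Icc a b) := by
  rintro ⟨ξ, t⟩ ⟨hξ, ht⟩
  obtain ⟨δ, hδ, hball⟩ := Metric.nhds_basis_closedBall.mem_iff.1 (isOpen_Ioo.mem_nhds hξ)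
  have hKc : IsCompact (Metric.closedBall ξ δ ×ˢ Icc a b) :=
    (isCompact_closedBall ξ δ).prod isCompact_Icc
  obtain ⟨C, hC⟩ := hKc.exists_bound_of_continuousOn (hf'.mono (prod_mono hball subset_rfl))
  have key : ContinuousOn (Function.uncurry f) (Metric.closedBall ξ δ ×ˢ Icc a b) := by
    refine continuousOn_prod_of_continuousOn_lipschitzOnWith _ C.toNNReal
      (fun η hη => hf η (hball hη)) (fun s hs => ?_)
    refine (convex_closedBall ξ δ).lipschitzOnWith_of_nnnorm_hasDerivWithin_le
      (f' := fun η => f' η s) (fun η hη => (hd η (hball hη) s hs).hasDerivWithinAt) fun η hη => ?_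
    exact NNReal.coe_le_coe.1 ((hC (η, s) ⟨hη, hs⟩).trans (Real.le_coe_toNNReal C))
  refine (key (ξ, t) ⟨Metric.mem_closedBall_self hδ.le, ht⟩).mono_of_mem_nhdsWithin ?_
  refine mem_nhdsWithin.2 ⟨Metric.ball ξ δ ×ˢ univ, Metric.isOpen_ball.prod isOpen_univ,
    ⟨Metric.mem_ball_self hδ, mem_univ _⟩, ?_⟩
  rintro ⟨η, s⟩ ⟨⟨h1, -⟩, -, h2⟩
  exact ⟨Metric.ball_subset_closedBall h1, h2⟩

/-- Finsler's lemma: a function which is positive on the zero set of a nonnegative function `g`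
becomes positive everywhere on a compact set upon adding a large multiple of `g`. -/
theorem exists_pos_add_mul {X : Type*} [TopologicalSpace X] {s : Set X} (hs : IsCompact s)
    {f g : X → ℝ} (hf : ContinuousOn f s) (hg : ContinuousOn g s) (hg0 : ∀ x ∈ s, 0 ≤ g x)
    (hfg : ∀ x ∈ s, g x = 0 → 0 < f x) : ∃ c : ℝ, 0 ≤ c ∧ ∀ x ∈ s, 0 < f x + c * g x := by
  obtain ⟨m, hm⟩ := hs.exists_bound_of_continuousOn hf
  have hsc : CompactSpace s := isCompact_iff_compactSpace.1 hs
  have hfc : Continuous (s.domRestrict f) := hf.domRestrict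
  have hgc : Continuous (s.domRestrict g) := hg.domRestrict
  have hcl : IsCompact {x : s | f x ≤ 0} := (isClosed_le hfc continuous_const).isCompact
  obtain ⟨k, hk, hkg⟩ : ∃ k > 0, ∀ x : s, f x ≤ 0 → k ≤ g x := by
    rcases {x : s | f x ≤ 0}.eq_empty_or_nonempty with he | hne
    · exact ⟨1, one_pos, fun x hx => absurd hx (eq_empty_iff_forall_notMem.1 he x)⟩
    · obtain ⟨x, hx, hmin⟩ := hcl.exists_isMinOn hne hgc.continuousOn
      refine ⟨g x, ?_, fun y hy => hmin hy⟩
      refine (hg0 x x.2).lt_of_ne fun h => ?_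
      exact absurd (hfg x x.2 h.symm) (not_lt.2 hx)
  have hc : 0 < (|m| + 1) / k := by positivity
  refine ⟨(|m| + 1) / k, hc.le, fun x hx => ?_⟩
  rcases le_or_gt (f x) 0 with h | h
  · have h1 := hkg ⟨x, hx⟩ h
    have h2 : |m| + 1 ≤ (|m| + 1) / k * g x := by
      rw [div_mul_eq_mul_div, le_div_iff₀ hk]
      exact mul_le_mul_of_nonneg_left h1 (by positivity)
    have h3 := hm x hx
    rw [Real.norm_eq_abs] at h3
    linarith [neg_abs_le (f x), le_abs_self m]
  · have := mul_nonneg hc.le (hg0 x hx)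
    linarith

/-- The derivative of `F t` at `y`, for `(t, y)` in an open set on which `F` is jointly smooth, is
jointly smooth. -/
theorem contDiffOn_fderiv_slice {Ω : Set (ℝ × E)} (hΩ : IsOpen Ω) {f : ℝ → E → F}
    (hf : ContDiffOn ℝ ∞ (Function.uncurry f) Ω) :
    ContDiffOn ℝ ∞ (Function.uncurry fun t y => fderiv ℝ (f t) y) Ω := by
  have h1 : ContDiffOn ℝ ∞ (fun x => (fderiv ℝ (Function.uncurry f) x).comp
      (ContinuousLinearMap.inr ℝ ℝ E)) Ω :=
    (hf.fderiv_of_isOpen hΩ (by simp)).clm_comp contDiffOn_const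
  refine h1.congr ?_
  rintro ⟨t, y⟩ hx
  have hd := ((hf.contDiffAt (hΩ.mem_nhds hx)).differentiableAt (by simp)).hasFDerivAt
  exact (hd.comp y (hasFDerivAt_prodMk_right t y)).fderiv

theorem differentiableAt_slice {Ω : Set (ℝ × E)} (hΩ : IsOpen Ω) {f : ℝ → E → F}
    (hf : ContDiffOn ℝ ∞ (Function.uncurry f) Ω) {t : ℝ} {y : E} (h : (t, y) ∈ Ω) :
    DifferentiableAt ℝ (f t) y := by
  have hd := ((hf.contDiffAt (hΩ.mem_nhds h)).differentiableAt (by simp)).hasFDerivAt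
  exact (hd.comp y (hasFDerivAt_prodMk_right t y)).differentiableAt

theorem hasDerivAt_comp_curve {f : E → F} {f' : E →L[ℝ] F} {u : ℝ → E} {u' : E} {s : ℝ}
    (hf : HasFDerivAt f f' (u s)) (hu : HasDerivAt u u' s) :
    HasDerivAt (fun s => f (u s)) (f' u') s :=
  hf.comp_hasDerivAt s hu

theorem hasDerivAt_clm_apply_curve {f : E → E →L[ℝ] F} {f' : E →L[ℝ] E →L[ℝ] F} {u w : ℝ → E}
    {u' w' : E} {s : ℝ} (hf : HasFDerivAt f f' (u s)) (hu : HasDerivAt u u' s)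
    (hw : HasDerivAt w w' s) :
    HasDerivAt (fun s => f (u s) (w s)) (f' u' (w s) + f (u s) w') s :=
  (hasDerivAt_comp_curve hf hu).clm_apply hw

end Analysis

section MatrixCalculus

variable {m : Type*} [Fintype m] [DecidableEq m]

attribute [local instance] Matrix.linftyOpNormedRing Matrix.linftyOpNormedAlgebra

/-- The derivative of `E K⁻¹`, for matrices which are differentiable entry by entry. -/
theorem hasDerivWithinAt_mul_inv_apply {K E : ℝ → Matrix m m ℝ} {K' E' : Matrix m m ℝ}
    {s : Set ℝ} {t : ℝ} (hK : ∀ i j, HasDerivWithinAt (fun u => K u i j) (K' i j) s t)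
    (hE : ∀ i j, HasDerivWithinAt (fun u => E u i j) (E' i j) s t) (hdet : (K t).det ≠ 0)
    (i j : m) :
    HasDerivWithinAt (fun u => (E u * (K u)⁻¹) i j)
      ((E' * (K t)⁻¹ - E t * (K t)⁻¹ * K' * (K t)⁻¹) i j) s t := by
  have hK1 : HasDerivWithinAt K K' s t :=
    hasDerivWithinAt_pi.2 fun i => hasDerivWithinAt_pi.2 fun j => hK i j
  have hE1 : HasDerivWithinAt E E' s t :=
    hasDerivWithinAt_pi.2 fun i => hasDerivWithinAt_pi.2 fun j => hE i j
  have hu : IsUnit (K t) := (Matrix.isUnit_iff_isUnit_det _).2 (isUnit_iff_ne_zero.2 hdet)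
  obtain ⟨x, hx⟩ := hu
  have hinv := hasFDerivAt_ringInverse (𝕜 := ℝ) x
  rw [hx] at hinv
  have h1 := hinv.comp_hasDerivWithinAt t hK1
  have hxi : (↑x⁻¹ : Matrix m m ℝ) = (K t)⁻¹ := by
    rw [← hx, Matrix.coe_units_inv]
  have h2 := hE1.mul h1
  have h3 := hasDerivWithinAt_pi.1 (hasDerivWithinAt_pi.1 h2 i) j
  refine (h3.congr_deriv ?_).congr_of_eventuallyEq ?_ ?_
  · simp only [Function.comp, ← Matrix.nonsing_inv_eq_ringInverse, hxi, neg_apply,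
      ContinuousLinearMap.mulLeftRight_apply, mul_neg, ← sub_eq_add_neg, mul_assoc]
  · exact Eventually.of_forall fun u => by
      simp [Function.comp, Matrix.nonsing_inv_eq_ringInverse]
  · simp [Function.comp, Matrix.nonsing_inv_eq_ringInverse]

theorem continuousOn_inv_apply {X : Type*} [TopologicalSpace X] {K : X → Matrix m m ℝ} {s : Set X}
    (hK : ∀ i j, ContinuousOn (fun u => K u i j) s) (hdet : ∀ u ∈ s, (K u).det ≠ 0) (i j : m) :
    ContinuousOn (fun u => (K u)⁻¹ i j) s := by
  have hK1 : ContinuousOn K s := continuousOn_pi.2 fun i => continuousOn_pi.2 fun j => hK i j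
  have h1 : ContinuousOn (fun u => (K u).det) s :=
    (Continuous.matrix_det continuous_id).comp_continuousOn hK1
  have h2 : ContinuousOn (fun u => (K u).adjugate i j) s :=
    (Continuous.matrix_elem (Continuous.matrix_adjugate continuous_id) i j).comp_continuousOn hK1
  simp only [Matrix.inv_def, Matrix.smul_apply, Ring.inverse_eq_inv', smul_eq_mul]
  exact (h1.inv₀ hdet).mul h2

end MatrixCalculus

end ConstrainedCalculus

/-! ### Coordinate expressions in a fibred chart -/

namespace ConstrainedCalculus
namespace ConstrainedSystem
namespace FibredChart

variable {n r : ℕ} {V A : Type*}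
  [TopologicalSpace V] [ChartedSpace (EventModel n) V] [IsManifold 𝓘(ℝ, EventModel n) ∞ V]
  [TopologicalSpace A] [ChartedSpace (VelModel n r) A] [IsManifold 𝓘(ℝ, VelModel n r) ∞ A]
  {S : ConstrainedSystem n r V A} (c : S.FibredChart)
  {L : A → ℝ} {t₀ t₁ : ℝ} {g : ℝ → A}

theorem contMDiffOn_chartA_symm :
    ContMDiffOn 𝓘(ℝ, VelModel n r) 𝓘(ℝ, VelModel n r) ∞ c.chartA.symm c.chartA.target :=
  contMDiffOn_symm_of_mem_maximalAtlas c.chartA_mem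

theorem contDiffOn_lag (hL : ContMDiff 𝓘(ℝ, VelModel n r) 𝓘(ℝ, ℝ) ∞ L) :
    ContDiffOn ℝ ∞ (Function.uncurry (c.lag L)) c.chartA.target :=
  (hL.comp_contMDiffOn c.contMDiffOn_chartA_symm).contDiffOn

theorem contDiffOn_psi : ContDiffOn ℝ ∞ (Function.uncurry c.psi) c.chartA.target := by
  have hjet : ContMDiffOn 𝓘(ℝ, VelModel n r) (𝓘(ℝ, EventModel n)).tangent ∞
      (fun x => S.jet (c.chartA.symm x)) c.chartA.target :=
    S.embedding.contMDiff.comp_contMDiffOn c.contMDiffOn_chartA_symm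
  have hV := (contMDiffOn_of_mem_maximalAtlas c.chartV_mem).contMDiffOn_tangentMapWithin
    (m := ∞) le_rfl c.chartV.open_source.uniqueMDiffOn
  have h1 := (contMDiff_snd_tangentBundle_modelSpace (EventModel n)
    𝓘(ℝ, EventModel n) (n := ∞)).comp_contMDiffOn (hV.comp hjet fun x hx =>
      c.proj_mem _ (c.chartA.map_target hx))
  refine (contDiff_snd.comp_contDiffOn h1.contDiffOn).congr ?_
  intro x hx
  have h2 := mfderivWithin_of_isOpen (I := 𝓘(ℝ, EventModel n)) (I' := 𝓘(ℝ, EventModel n))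
    (f := c.chartV) c.chartV.open_source (c.proj_mem _ (c.chartA.map_target hx))
  simp only [Function.comp, tangentMapWithin, jet, Function.uncurry, psi, h2]

variable {c}

theorem chartA_apply (hg : S.IsAdmissible t₀ t₁ g) (hgc : ∀ t ∈ Icc t₀ t₁, g t ∈ c.chartA.source)
    {t : ℝ} (ht : t ∈ Icc t₀ t₁) : c.chartA (g t) = (t, c.coord g t) := by
  have h := hgc t ht
  refine Prod.ext ?_ rfl
  rw [c.chartA_time _ h, c.chartV_time _ (c.proj_mem _ h), hg.time_eq t ht]

theorem mem_target (hg : S.IsAdmissible t₀ t₁ g) (hgc : ∀ t ∈ Icc t₀ t₁, g t ∈ c.chartA.source)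
    {t : ℝ} (ht : t ∈ Icc t₀ t₁) : (t, c.coord g t) ∈ c.chartA.target := by
  rw [← chartA_apply hg hgc ht]
  exact c.chartA.map_source (hgc t ht)

theorem chartA_symm_apply (hg : S.IsAdmissible t₀ t₁ g)
    (hgc : ∀ t ∈ Icc t₀ t₁, g t ∈ c.chartA.source)
    {t : ℝ} (ht : t ∈ Icc t₀ t₁) : c.chartA.symm (t, c.coord g t) = g t := by
  rw [← chartA_apply hg hgc ht, c.chartA.left_inv (hgc t ht)]

theorem continuousOn_coord (hg : S.IsAdmissible t₀ t₁ g)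
    (hgc : ∀ t ∈ Icc t₀ t₁, g t ∈ c.chartA.source) :
    ContinuousOn (c.coord g) (Icc t₀ t₁) :=
  continuous_snd.comp_continuousOn (c.chartA.continuousOn.comp hg.continuousOn hgc)

theorem lag_coord (hg : S.IsAdmissible t₀ t₁ g) (hgc : ∀ t ∈ Icc t₀ t₁, g t ∈ c.chartA.source)
    {t : ℝ} (ht : t ∈ Icc t₀ t₁) : c.lag L t (c.coord g t) = L (g t) := by
  rw [lag, chartA_symm_apply hg hgc ht]

/-- The coordinates of an admissible curve satisfy `dq/dt = ψ(t, q, z)`. -/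
theorem hasDerivWithinAt_coord_fst (hg : S.IsAdmissible t₀ t₁ g)
    (hgc : ∀ t ∈ Icc t₀ t₁, g t ∈ c.chartA.source) {t : ℝ} (ht : t ∈ Icc t₀ t₁) :
    HasDerivWithinAt (fun s => (c.coord g s).1) (c.psi t (c.coord g t)) (Icc t₀ t₁) t := by
  have hm := c.proj_mem _ (hgc t ht)
  have hV : HasMFDerivAt 𝓘(ℝ, EventModel n) 𝓘(ℝ, EventModel n) c.chartV (S.proj (g t))
      (mfderiv 𝓘(ℝ, EventModel n) 𝓘(ℝ, EventModel n) c.chartV (S.proj (g t))) :=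
    (((contMDiffOn_of_mem_maximalAtlas c.chartV_mem).contMDiffAt
      (c.chartV.open_source.mem_nhds hm)).mdifferentiableAt (by simp)).hasMFDerivAt
  have h1 := (hV.comp_hasMFDerivWithinAt t (hg.velocity t ht)).hasFDerivWithinAt
  have h2 := (hasFDerivAt_snd.comp_hasFDerivWithinAt t h1).hasDerivWithinAt
  have h3 : HasDerivWithinAt (fun s => (c.chartV (S.proj (g s))).2)
      (c.psi t (c.coord g t)) (Icc t₀ t₁) t := by
    refine h2.congr_deriv ?_
    rw [psi, chartA_symm_apply hg hgc ht]
    exact congrArg (fun v => (mfderiv 𝓘(ℝ, EventModel n) 𝓘(ℝ, EventModel n) c.chartV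
      (S.proj (g t)) v : EventModel n).2) (one_smul ℝ (S.vel (g t)))
  exact h3.congr (fun s hs => c.chartA_pos _ (hgc s hs)) (c.chartA_pos _ (hgc t ht))

end FibredChart
end ConstrainedSystem
end ConstrainedCalculus

/-! ### The adapted Lagrangian -/

namespace ConstrainedCalculus

/-- The linear form `x ↦ p_i x^i`. -/
def pairing {n : ℕ} (p : Fin n → ℝ) : (Fin n → ℝ) →L[ℝ] ℝ :=
  ∑ i, p i • ContinuousLinearMap.proj i

theorem pairing_apply {n : ℕ} (p x : Fin n → ℝ) : pairing p x = p ⬝ᵥ x := by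
  simp [pairing, dotProduct]

theorem continuous_pairing {n : ℕ} : Continuous (pairing : (Fin n → ℝ) → _) := by
  unfold pairing; fun_prop

namespace ConstrainedSystem
namespace FibredChart

variable {n r : ℕ} {V A : Type*}
  [TopologicalSpace V] [ChartedSpace (EventModel n) V] [IsManifold 𝓘(ℝ, EventModel n) ∞ V]
  [TopologicalSpace A] [ChartedSpace (VelModel n r) A] [IsManifold 𝓘(ℝ, VelModel n r) ∞ A]
  {S : ConstrainedSystem n r V A} (c : S.FibredChart)
  (L : A → ℝ) (t₀ t₁ : ℝ) (g : ℝ → A) (p : ℝ → Fin n → ℝ)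

/-- The derivative of the momenta on `[t₀, t₁]`, one-sided at the end-points. -/
def momentumDeriv (t₀ t₁ : ℝ) (p : ℝ → Fin n → ℝ) (t : ℝ) : Fin n → ℝ :=
  fun i => derivWithin (fun s => p s i) (Icc t₀ t₁) t

/-- The differential of the adapted Lagrangian with respect to `(q, z)`, at any point of the
chart. -/
def adaptedLagFDeriv (t : ℝ) (y : QZ n r) : QZ n r →L[ℝ] ℝ :=
  fderiv ℝ (c.lag L t) y
    - (pairing (momentumDeriv t₀ t₁ p t)).comp (ContinuousLinearMap.fst ℝ (Fin n → ℝ) (Fin r → ℝ))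
    - (pairing (p t)).comp (fderiv ℝ (c.psi t) y)

/-- The second differential of the adapted Lagrangian with respect to `(q, z)`, at any point of
the chart. -/
def adaptedLagFDeriv₂ (t : ℝ) (y : QZ n r) : QZ n r →L[ℝ] QZ n r →L[ℝ] ℝ :=
  fderiv ℝ (fun y' => fderiv ℝ (c.lag L t) y') y
    - (ContinuousLinearMap.compL ℝ (QZ n r) (Fin n → ℝ) ℝ (pairing (p t))).comp
        (fderiv ℝ (fun y' => fderiv ℝ (c.psi t) y') y)

variable {c L t₀ t₁ g p}

theorem adaptedLag_eq (t : ℝ) (y : QZ n r) : c.adaptedLag L t₀ t₁ g p t y =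
    c.lag L t y - pairing (momentumDeriv t₀ t₁ p t) (y.1 - (c.coord g t).1)
      - pairing (p t) (c.psi t y - fun i =>
          derivWithin (fun s => (c.coord g s).1 i) (Icc t₀ t₁) t) - L (g t) := by
  simp [adaptedLag, pairing, momentumDeriv]

theorem hasFDerivAt_adaptedLag (hL : ContMDiff 𝓘(ℝ, VelModel n r) 𝓘(ℝ, ℝ) ∞ L)
    {t : ℝ} {y : QZ n r} (h : (t, y) ∈ c.chartA.target) :
    HasFDerivAt (c.adaptedLag L t₀ t₁ g p t) (c.adaptedLagFDeriv L t₀ t₁ p t y) y := by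
  have h1 := (differentiableAt_slice c.chartA.open_target (c.contDiffOn_lag hL) h).hasFDerivAt
  have h2 := (differentiableAt_slice c.chartA.open_target c.contDiffOn_psi h).hasFDerivAt
  have h3 : HasFDerivAt (fun y : QZ n r => y.1) (ContinuousLinearMap.fst ℝ _ _) y := hasFDerivAt_fst
  have h4 := ((pairing (momentumDeriv t₀ t₁ p t)).hasFDerivAt.comp y
    (h3.sub_const (c.coord g t).1))
  have h5 := ((pairing (p t)).hasFDerivAt.comp y (h2.sub_const fun i =>
    derivWithin (fun s => (c.coord g s).1 i) (Icc t₀ t₁) t))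
  exact (((h1.sub h4).sub h5).sub_const (L (g t))).congr_of_eventuallyEq
    (Filter.Eventually.of_forall fun y' => adaptedLag_eq t y')

theorem hasFDerivAt_adaptedLagFDeriv (hL : ContMDiff 𝓘(ℝ, VelModel n r) 𝓘(ℝ, ℝ) ∞ L)
    {t : ℝ} {y : QZ n r} (h : (t, y) ∈ c.chartA.target) :
    HasFDerivAt (c.adaptedLagFDeriv L t₀ t₁ p t) (c.adaptedLagFDeriv₂ L p t y) y := by
  have h1 := (differentiableAt_slice c.chartA.open_target
    (contDiffOn_fderiv_slice c.chartA.open_target (c.contDiffOn_lag hL)) h).hasFDerivAt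
  have h2 := (differentiableAt_slice c.chartA.open_target
    (contDiffOn_fderiv_slice c.chartA.open_target c.contDiffOn_psi) h).hasFDerivAt
  exact (h1.sub_const _).sub
    ((ContinuousLinearMap.compL ℝ (QZ n r) (Fin n → ℝ) ℝ (pairing (p t))).hasFDerivAt.comp y h2)

theorem eventually_mem_target {t : ℝ} {y : QZ n r} (h : (t, y) ∈ c.chartA.target) :
    ∀ᶠ y' in 𝓝 y, (t, y') ∈ c.chartA.target :=
  (Continuous.prodMk_right t).continuousAt.eventually (c.chartA.open_target.mem_nhds h)

theorem hess_eq (hL : ContMDiff 𝓘(ℝ, VelModel n r) 𝓘(ℝ, ℝ) ∞ L)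
    {t : ℝ} (h : (t, c.coord g t) ∈ c.chartA.target) (u v : QZ n r) :
    c.hess L t₀ t₁ g p t u v = c.adaptedLagFDeriv₂ L p t (c.coord g t) u v := by
  have h1 : (fun y => fderiv ℝ (c.adaptedLag L t₀ t₁ g p t) y) =ᶠ[𝓝 (c.coord g t)]
      c.adaptedLagFDeriv L t₀ t₁ p t := by
    filter_upwards [eventually_mem_target h] with y hy
    exact (hasFDerivAt_adaptedLag hL hy).fderiv
  rw [hess, hessian, h1.fderiv_eq, (hasFDerivAt_adaptedLagFDeriv hL h).fderiv]

/-- `G_AB` is the hessian of the adapted Lagrangian in the vertical directions: `ℒ'` and `-ℋ` differ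
by a function which is affine in `q` at each time. -/
theorem G_apply (hL : ContMDiff 𝓘(ℝ, VelModel n r) 𝓘(ℝ, ℝ) ∞ L)
    {t : ℝ} (h : (t, c.coord g t) ∈ c.chartA.target) (α β : Fin r) :
    c.G L g p t α β = c.adaptedLagFDeriv₂ L p t (c.coord g t) (dz n α) (dz n β) := by
  have h1 : ∀ y, (t, y) ∈ c.chartA.target →
      HasFDerivAt (fun y => c.hamiltonian L t y (p t))
        (-(c.adaptedLagFDeriv L t t p t y +
          (pairing (momentumDeriv t t p t)).comp
            (ContinuousLinearMap.fst ℝ (Fin n → ℝ) (Fin r → ℝ)))) y := by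
    intro y hy
    have h1 := (differentiableAt_slice c.chartA.open_target (c.contDiffOn_lag hL) hy).hasFDerivAt
    have h2 := (differentiableAt_slice c.chartA.open_target c.contDiffOn_psi hy).hasFDerivAt
    have h3 := ((pairing (p t)).hasFDerivAt.comp y h2).sub h1
    refine (h3.congr_fderiv ?_).congr_of_eventuallyEq (Filter.Eventually.of_forall fun y' => ?_)
    · rw [adaptedLagFDeriv]; abel
    · simp [hamiltonian, pairing]
  have h2 : (fun y => fderiv ℝ (fun y => c.hamiltonian L t y (p t)) y) =ᶠ[𝓝 (c.coord g t)]
      fun y => (-(c.adaptedLagFDeriv L t t p t y +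
          (pairing (momentumDeriv t t p t)).comp
            (ContinuousLinearMap.fst ℝ (Fin n → ℝ) (Fin r → ℝ)))) := by
    filter_upwards [eventually_mem_target h] with y hy
    exact (h1 y hy).fderiv
  rw [G, Matrix.of_apply, hessian, h2.fderiv_eq,
    ((hasFDerivAt_adaptedLagFDeriv hL h).add_const _).fun_neg.fderiv]
  simp

theorem adaptedLagFDeriv₂_symm (hL : ContMDiff 𝓘(ℝ, VelModel n r) 𝓘(ℝ, ℝ) ∞ L)
    {t : ℝ} {y : QZ n r} (h : (t, y) ∈ c.chartA.target) (u v : QZ n r) :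
    c.adaptedLagFDeriv₂ L p t y u v = c.adaptedLagFDeriv₂ L p t y v u := by
  refine second_derivative_symmetric_of_eventually (𝕜 := ℝ)
    (f := c.adaptedLag L t t (fun _ => c.chartA.symm (t, y)) p t)
    (f' := c.adaptedLagFDeriv L t t p t) ?_ (hasFDerivAt_adaptedLagFDeriv hL h) u v
  filter_upwards [eventually_mem_target h] with y hy
  exact hasFDerivAt_adaptedLag hL hy

theorem momentumDeriv_apply (hp : c.IsPontryagin L t₀ t₁ g p) (ht : t₀ < t₁) {t : ℝ}
    (h : t ∈ Icc t₀ t₁) (i : Fin n) :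
    momentumDeriv t₀ t₁ p t i = c.dlag L g t (dq r i) - ∑ k, c.dpsi g t (dq r i) k * p t k :=
  (hp.deriv_p t h i).derivWithin (uniqueDiffOn_Icc ht t h)

theorem eq_sum_dq_add_sum_dz (u : QZ n r) :
    u = ∑ i, u.1 i • dq r i + ∑ α, u.2 α • dz n α := by
  refine Prod.ext ?_ ?_
  · ext j; simp [dq, dz, Prod.fst_sum, Finset.sum_apply, Pi.single_apply]
  · ext j; simp [dq, dz, Prod.snd_sum, Finset.sum_apply, Pi.single_apply]

/-- The Pontryagin equations say that the adapted Lagrangian is critical along the extremal: the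
differential equation for the momenta gives the derivatives in `q`, the algebraic one those in `z`.
-/
theorem adaptedLagFDeriv_coord (hp : c.IsPontryagin L t₀ t₁ g p) (ht : t₀ < t₁) {t : ℝ}
    (h : t ∈ Icc t₀ t₁) : c.adaptedLagFDeriv L t₀ t₁ p t (c.coord g t) = 0 := by
  have hq : ∀ i, c.adaptedLagFDeriv L t₀ t₁ p t (c.coord g t) (dq r i) = 0 := by
    intro i
    have h1 := momentumDeriv_apply hp ht h i
    simp only [dlag, dpsi] at h1
    have h2 : (pairing (momentumDeriv t₀ t₁ p t)) (dq r i).1 = momentumDeriv t₀ t₁ p t i := by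
      simp [pairing_apply, dq]
    simp only [adaptedLagFDeriv, sub_apply, ContinuousLinearMap.comp_apply,
      ContinuousLinearMap.coe_fst', h2, h1]
    simp [pairing, mul_comm]
  have hz : ∀ α, c.adaptedLagFDeriv L t₀ t₁ p t (c.coord g t) (dz n α) = 0 := by
    intro α
    have h1 := hp.stationary t h α
    simp only [dlag, dpsi] at h1
    have h2 : (pairing (momentumDeriv t₀ t₁ p t)) (dz n α).1 = 0 := by simp [dz]
    simp only [adaptedLagFDeriv, sub_apply, ContinuousLinearMap.comp_apply,
      ContinuousLinearMap.coe_fst', h2, ← h1]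
    simp [pairing]
  refine ContinuousLinearMap.ext fun u => ?_
  rw [eq_sum_dq_add_sum_dz u]
  simp [hq, hz]

/-- The points of the chart at times in `[t₀, t₁]`. -/
def slab (c : S.FibredChart) (t₀ t₁ : ℝ) : Set (ℝ × QZ n r) :=
  c.chartA.target ∩ Prod.fst ⁻¹' Icc t₀ t₁

theorem continuousOn_psi : ContinuousOn (Function.uncurry c.psi) c.chartA.target :=
  c.contDiffOn_psi.continuousOn

theorem continuousOn_fderiv_psi :
    ContinuousOn (Function.uncurry fun t y => fderiv ℝ (c.psi t) y) c.chartA.target :=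
  (contDiffOn_fderiv_slice c.chartA.open_target c.contDiffOn_psi).continuousOn

theorem continuousOn_fderiv₂_psi :
    ContinuousOn (Function.uncurry fun t y => fderiv ℝ (fun y' => fderiv ℝ (c.psi t) y') y)
      c.chartA.target :=
  (contDiffOn_fderiv_slice c.chartA.open_target
    (contDiffOn_fderiv_slice c.chartA.open_target c.contDiffOn_psi)).continuousOn

theorem continuousOn_fderiv_lag (hL : ContMDiff 𝓘(ℝ, VelModel n r) 𝓘(ℝ, ℝ) ∞ L) :
    ContinuousOn (Function.uncurry fun t y => fderiv ℝ (c.lag L t) y) c.chartA.target :=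
  (contDiffOn_fderiv_slice c.chartA.open_target (c.contDiffOn_lag hL)).continuousOn

theorem continuousOn_fderiv₂_lag (hL : ContMDiff 𝓘(ℝ, VelModel n r) 𝓘(ℝ, ℝ) ∞ L) :
    ContinuousOn (Function.uncurry fun t y => fderiv ℝ (fun y' => fderiv ℝ (c.lag L t) y') y)
      c.chartA.target :=
  (contDiffOn_fderiv_slice c.chartA.open_target
    (contDiffOn_fderiv_slice c.chartA.open_target (c.contDiffOn_lag hL))).continuousOn

/-- Composition with the curve of coordinates turns functions on the chart into functions of
time. -/
theorem continuousOn_along {F : Type*} [TopologicalSpace F] {f : ℝ → QZ n r → F}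
    (hf : ContinuousOn (Function.uncurry f) c.chartA.target) (hg : S.IsAdmissible t₀ t₁ g)
    (hgc : ∀ t ∈ Icc t₀ t₁, g t ∈ c.chartA.source) :
    ContinuousOn (fun t => f t (c.coord g t)) (Icc t₀ t₁) :=
  hf.comp (f := fun t => (t, c.coord g t)) (continuousOn_id.prodMk (continuousOn_coord hg hgc))
    fun _ ht => mem_target hg hgc ht

theorem continuousOn_momentum (hp : c.IsPontryagin L t₀ t₁ g p) : ContinuousOn p (Icc t₀ t₁) :=
  continuousOn_pi.2 fun i t ht => (hp.deriv_p t ht i).continuousWithinAt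

theorem continuousOn_dpsi (hg : S.IsAdmissible t₀ t₁ g)
    (hgc : ∀ t ∈ Icc t₀ t₁, g t ∈ c.chartA.source) {X : ℝ → QZ n r}
    (hX : ContinuousOn X (Icc t₀ t₁)) : ContinuousOn (fun t => c.dpsi g t (X t)) (Icc t₀ t₁) :=
  (continuousOn_along continuousOn_fderiv_psi hg hgc).clm_apply hX

theorem continuousOn_momentumDeriv (hL : ContMDiff 𝓘(ℝ, VelModel n r) 𝓘(ℝ, ℝ) ∞ L)
    (hg : S.IsAdmissible t₀ t₁ g) (hgc : ∀ t ∈ Icc t₀ t₁, g t ∈ c.chartA.source)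
    (hp : c.IsPontryagin L t₀ t₁ g p) (ht : t₀ < t₁) :
    ContinuousOn (momentumDeriv t₀ t₁ p) (Icc t₀ t₁) := by
  refine continuousOn_pi.2 fun i => ContinuousOn.congr ?_ fun t h =>
    momentumDeriv_apply hp ht h i
  refine ((continuousOn_along (continuousOn_fderiv_lag hL) hg hgc).clm_apply
    continuousOn_const).sub (continuousOn_finsetSum _ fun k _ => ContinuousOn.mul ?_ ?_)
  · exact continuousOn_pi.1 (continuousOn_dpsi hg hgc continuousOn_const) k
  · exact continuousOn_pi.1 (continuousOn_momentum hp) k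

theorem continuousOn_comp_fst {F : Type*} [TopologicalSpace F] {f : ℝ → F}
    (hf : ContinuousOn f (Icc t₀ t₁)) :
    ContinuousOn (fun x : ℝ × QZ n r => f x.1) (c.slab t₀ t₁) :=
  hf.comp continuous_fst.continuousOn fun _ hx => hx.2

theorem continuousOn_adaptedLagFDeriv (hL : ContMDiff 𝓘(ℝ, VelModel n r) 𝓘(ℝ, ℝ) ∞ L)
    (hg : S.IsAdmissible t₀ t₁ g) (hgc : ∀ t ∈ Icc t₀ t₁, g t ∈ c.chartA.source)
    (hp : c.IsPontryagin L t₀ t₁ g p) (ht : t₀ < t₁) :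
    ContinuousOn (Function.uncurry (c.adaptedLagFDeriv L t₀ t₁ p)) (c.slab t₀ t₁) := by
  refine (((continuousOn_fderiv_lag hL).mono inter_subset_left).sub
    (ContinuousOn.clm_comp ?_ continuousOn_const)).sub
    (ContinuousOn.clm_comp ?_ (continuousOn_fderiv_psi.mono inter_subset_left))
  · exact continuous_pairing.comp_continuousOn
      (continuousOn_comp_fst (continuousOn_momentumDeriv hL hg hgc hp ht))
  · exact continuous_pairing.comp_continuousOn (continuousOn_comp_fst (continuousOn_momentum hp))

theorem continuousOn_adaptedLagFDeriv₂ (hL : ContMDiff 𝓘(ℝ, VelModel n r) 𝓘(ℝ, ℝ) ∞ L)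
    (hp : c.IsPontryagin L t₀ t₁ g p) :
    ContinuousOn (Function.uncurry (c.adaptedLagFDeriv₂ L p)) (c.slab t₀ t₁) := by
  have h1 : ContinuousOn (fun x : ℝ × QZ n r =>
      ContinuousLinearMap.compL ℝ (QZ n r) (Fin n → ℝ) ℝ (pairing (p x.1))) (c.slab t₀ t₁) :=
    (ContinuousLinearMap.continuous _).comp_continuousOn
      (continuous_pairing.comp_continuousOn (continuousOn_comp_fst (continuousOn_momentum hp)))
  have h2 := h1.clm_comp ((continuousOn_fderiv₂_psi (c := c)).mono inter_subset_left)
  have h3 := (continuousOn_fderiv₂_lag (c := c) hL).mono (inter_subset_left : c.slab t₀ t₁ ⊆ _)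
  exact continuousOn_clm_apply.2 fun u =>
    (continuousOn_clm_apply.1 h3 u).sub (continuousOn_clm_apply.1 h2 u)

theorem derivWithin_coord_fst (hg : S.IsAdmissible t₀ t₁ g)
    (hgc : ∀ t ∈ Icc t₀ t₁, g t ∈ c.chartA.source) (ht : t₀ < t₁) {t : ℝ} (h : t ∈ Icc t₀ t₁) :
    (fun i => derivWithin (fun s => (c.coord g s).1 i) (Icc t₀ t₁) t) =
      c.psi t (c.coord g t) := by
  ext i
  exact (hasDerivWithinAt_pi.1 (hasDerivWithinAt_coord_fst hg hgc h) i).derivWithin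
    (uniqueDiffOn_Icc ht t h)

theorem adaptedLag_eq_of_mem (hg : S.IsAdmissible t₀ t₁ g)
    (hgc : ∀ t ∈ Icc t₀ t₁, g t ∈ c.chartA.source) (ht : t₀ < t₁) {t : ℝ} (h : t ∈ Icc t₀ t₁)
    (y : QZ n r) : c.adaptedLag L t₀ t₁ g p t y =
    c.lag L t y - pairing (momentumDeriv t₀ t₁ p t) (y.1 - (c.coord g t).1)
      - pairing (p t) (c.psi t y - c.psi t (c.coord g t)) - L (g t) := by
  rw [adaptedLag_eq, derivWithin_coord_fst hg hgc ht h]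

theorem adaptedLag_coord (hg : S.IsAdmissible t₀ t₁ g)
    (hgc : ∀ t ∈ Icc t₀ t₁, g t ∈ c.chartA.source) (ht : t₀ < t₁) {t : ℝ} (h : t ∈ Icc t₀ t₁) :
    c.adaptedLag L t₀ t₁ g p t (c.coord g t) = 0 := by
  rw [adaptedLag_eq_of_mem hg hgc ht h, lag_coord hg hgc h]
  simp

theorem continuousOn_L (hL : ContMDiff 𝓘(ℝ, VelModel n r) 𝓘(ℝ, ℝ) ∞ L)
    (hg : S.IsAdmissible t₀ t₁ g) : ContinuousOn (fun t => L (g t)) (Icc t₀ t₁) :=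
  hL.continuous.comp_continuousOn hg.continuousOn

theorem continuousOn_adaptedLag (hL : ContMDiff 𝓘(ℝ, VelModel n r) 𝓘(ℝ, ℝ) ∞ L)
    (hg : S.IsAdmissible t₀ t₁ g) (hgc : ∀ t ∈ Icc t₀ t₁, g t ∈ c.chartA.source)
    (hp : c.IsPontryagin L t₀ t₁ g p) (ht : t₀ < t₁) :
    ContinuousOn (Function.uncurry (c.adaptedLag L t₀ t₁ g p)) (c.slab t₀ t₁) := by
  have h1 : ContinuousOn (fun x : ℝ × QZ n r => c.psi x.1 x.2) (c.slab t₀ t₁) :=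
    continuousOn_psi.mono inter_subset_left
  have h2 : ContinuousOn (fun x : ℝ × QZ n r => c.lag L x.1 x.2) (c.slab t₀ t₁) :=
    (c.contDiffOn_lag hL).continuousOn.mono inter_subset_left
  refine ContinuousOn.congr (((h2.sub (ContinuousOn.clm_apply (continuous_pairing.comp_continuousOn
      (continuousOn_comp_fst (continuousOn_momentumDeriv hL hg hgc hp ht)))
      ((continuous_fst.comp continuous_snd).continuousOn.sub
        (continuous_fst.comp_continuousOn (continuousOn_comp_fst (continuousOn_coord hg hgc)))))).sub
      (ContinuousOn.clm_apply (continuous_pairing.comp_continuousOn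
      (continuousOn_comp_fst (continuousOn_momentum hp)))
      (h1.sub (continuousOn_comp_fst (continuousOn_along continuousOn_psi hg hgc))))).sub
      (continuousOn_comp_fst (continuousOn_L hL hg))) ?_
  rintro ⟨t, y⟩ hx
  exact adaptedLag_eq_of_mem hg hgc ht hx.2 y

/-- The action of an admissible section with the same end-points differs from that of `g` by the
integral of the adapted Lagrangian, because the difference of the integrands is the derivative of
`p_i (q^i - q^i(t))`. -/
theorem action_sub_action (hL : ContMDiff 𝓘(ℝ, VelModel n r) 𝓘(ℝ, ℝ) ∞ L)
    (hg : S.IsAdmissible t₀ t₁ g) (hgc : ∀ t ∈ Icc t₀ t₁, g t ∈ c.chartA.source)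
    (hp : c.IsPontryagin L t₀ t₁ g p) (ht : t₀ < t₁) {g' : ℝ → A}
    (hg' : S.IsAdmissible t₀ t₁ g') (hgc' : ∀ t ∈ Icc t₀ t₁, g' t ∈ c.chartA.source)
    (h₀ : (c.coord g' t₀).1 = (c.coord g t₀).1) (h₁ : (c.coord g' t₁).1 = (c.coord g t₁).1) :
    action L t₀ t₁ g' = action L t₀ t₁ g +
      ∫ t in t₀..t₁, c.adaptedLag L t₀ t₁ g p t (c.coord g' t) := by
  have hI : ∀ f : ℝ → ℝ, ContinuousOn f (Icc t₀ t₁) →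
      IntervalIntegrable f MeasureTheory.volume t₀ t₁ := fun f hf =>
    ContinuousOn.intervalIntegrable (by rwa [uIcc_of_le ht.le])
  have hpd : ∀ t ∈ Icc t₀ t₁, HasDerivWithinAt p (momentumDeriv t₀ t₁ p t) (Icc t₀ t₁) t :=
    fun t h => hasDerivWithinAt_pi.2 fun i =>
      (hp.deriv_p t h i).congr_deriv (momentumDeriv_apply hp ht h i).symm
  have hx : ∀ t ∈ Icc t₀ t₁, HasDerivWithinAt (fun s => (c.coord g' s).1 - (c.coord g s).1)
      (c.psi t (c.coord g' t) - c.psi t (c.coord g t)) (Icc t₀ t₁) t := fun t h =>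
    (hasDerivWithinAt_coord_fst hg' hgc' h).sub (hasDerivWithinAt_coord_fst hg hgc h)
  have hcx : ContinuousOn (fun s => (c.coord g' s).1 - (c.coord g s).1) (Icc t₀ t₁) :=
    fun t h => (hx t h).continuousWithinAt
  have hcx' : ContinuousOn (fun t => c.psi t (c.coord g' t) - c.psi t (c.coord g t))
      (Icc t₀ t₁) := (continuousOn_along continuousOn_psi hg' hgc').sub
        (continuousOn_along continuousOn_psi hg hgc)
  have hc1 : ContinuousOn (fun t => pairing (momentumDeriv t₀ t₁ p t)
      ((c.coord g' t).1 - (c.coord g t).1) + pairing (p t) (c.psi t (c.coord g' t) -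
        c.psi t (c.coord g t))) (Icc t₀ t₁) :=
    ((continuous_pairing.comp_continuousOn
      (continuousOn_momentumDeriv hL hg hgc hp ht)).clm_apply hcx).add
      ((continuous_pairing.comp_continuousOn (continuousOn_momentum hp)).clm_apply hcx')
  have hd : ∀ t ∈ Icc t₀ t₁, HasDerivWithinAt
      (fun s => pairing (p s) ((c.coord g' s).1 - (c.coord g s).1))
      (pairing (momentumDeriv t₀ t₁ p t) ((c.coord g' t).1 - (c.coord g t).1) +
        pairing (p t) (c.psi t (c.coord g' t) - c.psi t (c.coord g t))) (Icc t₀ t₁) t := by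
    intro t h
    have h1 := HasDerivWithinAt.fun_sum (u := Finset.univ) fun i _ =>
      (hasDerivWithinAt_pi.1 (hpd t h) i).mul (hasDerivWithinAt_pi.1 (hx t h) i)
    simpa only [pairing_apply, dotProduct, Finset.sum_add_distrib, Pi.mul_apply] using h1
  have h0 := integral_eq_sub_of_hasDerivWithinAt_Icc ht.le hd hc1
  rw [h₀, h₁] at h0
  simp only [sub_self, map_zero] at h0
  have hcc : ∀ t ∈ uIcc t₀ t₁, c.adaptedLag L t₀ t₁ g p t (c.coord g' t) = L (g' t) - L (g t) -
      (pairing (momentumDeriv t₀ t₁ p t) ((c.coord g' t).1 - (c.coord g t).1) +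
        pairing (p t) (c.psi t (c.coord g' t) - c.psi t (c.coord g t))) := by
    intro t h
    rw [uIcc_of_le ht.le] at h
    rw [adaptedLag_eq_of_mem hg hgc ht h, lag_coord hg' hgc' h]
    ring
  rw [intervalIntegral.integral_congr hcc, intervalIntegral.integral_sub
    ((hI _ (continuousOn_L hL hg')).sub (hI _ (continuousOn_L hL hg))) (hI _ hc1), h0,
    intervalIntegral.integral_sub (hI _ (continuousOn_L hL hg')) (hI _ (continuousOn_L hL hg)),
    action, action]
  ring

end FibredChart
end ConstrainedSystem
end ConstrainedCalculus

/-! ### Completion of the square -/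

namespace ConstrainedCalculus

open ConstrainedSystem.FibredChart Matrix

section Algebra

variable {n r : ℕ}

theorem dotProduct_mulVec_comm_of_isSymm {m : Type*} [Fintype m] {G : Matrix m m ℝ}
    (hG : G.IsSymm) (x y : m → ℝ) : x ⬝ᵥ G *ᵥ y = (G *ᵥ x) ⬝ᵥ y := by
  rw [dotProduct_mulVec, ← mulVec_transpose, hG.eq]

theorem apply_sum_smul_sum_smul {ι κ E : Type*} [Fintype ι] [Fintype κ] [NormedAddCommGroup E]
    [NormedSpace ℝ E] (b : E →L[ℝ] E →L[ℝ] ℝ) (e : ι → E) (f : κ → E) (x : ι → ℝ) (y : κ → ℝ) :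
    b (∑ i, x i • e i) (∑ j, y j • f j) = x ⬝ᵥ (Matrix.of fun i j => b (e i) (f j)) *ᵥ y := by
  simp only [map_sum, map_smul, _root_.sum_apply, _root_.smul_apply, smul_eq_mul,
    dotProduct, mulVec, Matrix.of_apply, Finset.mul_sum]
  rw [Finset.sum_comm]
  exact Finset.sum_congr rfl fun i _ => Finset.sum_congr rfl fun j _ => by ring

/-- Completion of the square: along a symmetric solution `W` of the Riccati equation `W' = N + ᵗT W
+ W T - W M W` the quadratic form `b`, diminished by the total derivative of `W_ij X^i X^j`, is the
value of `G` at the vertical vector `Z = Γ - h X - G⁻¹ (ᵗB W X)`, where `B` is the matrix of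
`∂ψ/∂z`. -/
theorem sub_riccati_eq_dotProduct (b : QZ n r →L[ℝ] QZ n r →L[ℝ] ℝ)
    (hb : ∀ u v, b u v = b v u) (d : QZ n r →L[ℝ] (Fin n → ℝ)) {G : Matrix (Fin r) (Fin r) ℝ}
    (hGb : ∀ α β, G α β = b (dz n α) (dz n β)) (hG : IsUnit G.det)
    {h : Fin n → Fin r → ℝ} (hh : ∀ i α, h i α = -∑ β, G⁻¹ α β * b (dq r i) (dz n β))
    {N M T W W' : Matrix (Fin n) (Fin n) ℝ}
    (hN : ∀ i j, N i j = b (Pi.single i 1, h i) (Pi.single j 1, h j))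
    (hM : ∀ i j, M i j = ∑ α, ∑ β, G⁻¹ α β * d (dz n α) i * d (dz n β) j)
    (hT : ∀ i k, T i k = -d (Pi.single k 1, h k) i) (hW : W.IsSymm)
    (hW' : W' = N + Tᵀ * W + W * T - W * M * W) (v : QZ n r) :
    ∃ Z : Fin r → ℝ, b v v - v.1 ⬝ᵥ W' *ᵥ v.1 - 2 * (d v ⬝ᵥ W *ᵥ v.1) = Z ⬝ᵥ G *ᵥ Z ∧
      (v.1 = 0 → Z = v.2) := by
  have hGs : G.IsSymm := Matrix.IsSymm.ext fun α β => by rw [hGb, hGb, hb]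
  set e : Fin n → QZ n r := fun i => (Pi.single i 1, h i) with he
  have hhor : ∀ i β, b (e i) (dz n β) = 0 := by
    intro i β
    have h1 : e i = dq r i + ∑ α, h i α • dz n α := by
      rw [he]
      refine Prod.ext ?_ ?_
      · ext j; simp [dq, dz, Prod.fst_sum]
      · ext j; simp [dq, dz, Prod.snd_sum, Finset.sum_apply, Pi.single_apply]
    have h2 : h i = -(G⁻¹ *ᵥ fun β => b (dq r i) (dz n β)) := by
      ext α; rw [hh]; rfl
    have h3 : (G *ᵥ h i) β = -b (dq r i) (dz n β) := by
      rw [h2, mulVec_neg, mulVec_mulVec, mul_nonsing_inv _ hG, one_mulVec]; rfl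
    have h4 : (G *ᵥ h i) β = ∑ α, h i α * b (dz n α) (dz n β) := by
      simp only [mulVec, dotProduct]
      exact Finset.sum_congr rfl fun α _ => by rw [← hGs.apply, hGb, mul_comm]
    rw [h1, map_add, map_sum]
    simp only [map_smul, _root_.add_apply, _root_.sum_apply, _root_.smul_apply, smul_eq_mul, ← h4,
      h3]
    ring
  set X := v.1 with hX
  set Y : Fin r → ℝ := v.2 - ∑ i, X i • h i with hY
  have hv : v = ∑ i, X i • e i + ∑ α, Y α • dz n α := by
    rw [he]
    refine Prod.ext ?_ ?_
    · ext j; simp [dz, Prod.fst_sum, Finset.sum_apply, Pi.single_apply, hX]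
    · ext j; simp [dz, Prod.snd_sum, Finset.sum_apply, Pi.single_apply, hY]
  have hbv : b v v = X ⬝ᵥ N *ᵥ X + Y ⬝ᵥ G *ᵥ Y := by
    have h1 : b (∑ i, X i • e i) (∑ α, Y α • dz n α) = 0 := by
      rw [apply_sum_smul_sum_smul]
      have : (Matrix.of fun i j => b (e i) (dz n j)) = 0 := by ext i j; exact hhor i j
      rw [this, zero_mulVec, dotProduct_zero]
    have h2 : (Matrix.of fun i j => b (e i) (e j)) = N := by ext i j; exact (hN i j).symm
    have h3 : (Matrix.of fun i j => b (dz n i) (dz n j)) = G := by ext i j; exact (hGb i j).symm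
    rw [hv, map_add b, _root_.add_apply, map_add, map_add, hb (∑ α, Y α • dz n α) (∑ i, X i • e i),
      h1, apply_sum_smul_sum_smul, apply_sum_smul_sum_smul, h2, h3]
    ring
  set w := W *ᵥ X with hw
  set β : Fin r → ℝ := fun α => w ⬝ᵥ d (dz n α) with hβ
  have hdv : w ⬝ᵥ d v = -(w ⬝ᵥ T *ᵥ X) + β ⬝ᵥ Y := by
    have h1 : d (∑ i, X i • e i) = -(T *ᵥ X) := by
      ext j
      rw [map_sum]
      simp only [map_smul, Finset.sum_apply, Pi.smul_apply, smul_eq_mul, Pi.neg_apply, mulVec,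
        dotProduct, hT, he, neg_mul, Finset.sum_neg_distrib, neg_neg]
      exact Finset.sum_congr rfl fun i _ => mul_comm _ _
    rw [hv, map_add, h1, dotProduct_add, dotProduct_neg, map_sum]
    congr 1
    simp only [map_smul, dotProduct_sum, dotProduct_smul, smul_eq_mul, hβ]
    exact Finset.sum_congr rfl fun α _ => mul_comm _ _
  have hMw : w ⬝ᵥ M *ᵥ w = β ⬝ᵥ G⁻¹ *ᵥ β := by
    have h1 : M = Matrix.of (fun i α => d (dz n α) i) * G⁻¹ *
        (Matrix.of fun α j => d (dz n α) j) := by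
      ext i j
      simp only [Matrix.mul_apply, Matrix.of_apply, hM, Finset.sum_mul]
      rw [Finset.sum_comm]
      exact Finset.sum_congr rfl fun α _ => Finset.sum_congr rfl fun γ _ => by ring
    have h2 : (Matrix.of fun α j => d (dz n α) j) *ᵥ w = β := by
      ext α; simp [mulVec, dotProduct, hβ, mul_comm]
    have h3 : w ᵥ* (Matrix.of fun i α => d (dz n α) i) = β := by
      ext α; simp [vecMul, dotProduct, hβ]
    rw [h1, ← mulVec_mulVec, ← mulVec_mulVec, dotProduct_mulVec, h2, h3]
  have hXW : X ⬝ᵥ W' *ᵥ X = X ⬝ᵥ N *ᵥ X + 2 * (w ⬝ᵥ T *ᵥ X) - w ⬝ᵥ M *ᵥ w := by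
    have h1 : X ⬝ᵥ (Tᵀ * W) *ᵥ X = w ⬝ᵥ T *ᵥ X := by
      rw [← mulVec_mulVec, dotProduct_mulVec, vecMul_transpose, dotProduct_comm]
    have h2 : X ⬝ᵥ (W * T) *ᵥ X = w ⬝ᵥ T *ᵥ X := by
      rw [← mulVec_mulVec, dotProduct_mulVec_comm_of_isSymm hW]
    have h3 : X ⬝ᵥ (W * M * W) *ᵥ X = w ⬝ᵥ M *ᵥ w := by
      rw [← mulVec_mulVec, ← mulVec_mulVec, dotProduct_mulVec_comm_of_isSymm hW]
    rw [hW', sub_mulVec, add_mulVec, add_mulVec, dotProduct_sub, dotProduct_add, dotProduct_add,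
      h1, h2, h3]
    ring
  refine ⟨Y - G⁻¹ *ᵥ β, ?_, fun h0 => ?_⟩
  · have h1 : G *ᵥ (Y - G⁻¹ *ᵥ β) = G *ᵥ Y - β := by
      rw [mulVec_sub, mulVec_mulVec, mul_nonsing_inv _ hG, one_mulVec]
    have h2 : (G⁻¹ *ᵥ β) ⬝ᵥ G *ᵥ Y = β ⬝ᵥ Y := by
      rw [dotProduct_mulVec_comm_of_isSymm hGs, mulVec_mulVec, mul_nonsing_inv _ hG, one_mulVec]
    rw [h1, sub_dotProduct, dotProduct_sub, dotProduct_sub, h2, hbv, hXW, dotProduct_comm (d v), hdv,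
      hMw, dotProduct_comm Y β, dotProduct_comm (G⁻¹ *ᵥ β) β]
    ring
  · have hw0 : w = 0 := by rw [hw, h0, mulVec_zero]
    have hβ0 : β = 0 := by ext α; simp [hβ, hw0]
    rw [hβ0, mulVec_zero, sub_zero, hY, h0]
    simp

end Algebra

end ConstrainedCalculus

/-! ### The Riccati equation and a strictly positive calibrated form -/

namespace ConstrainedCalculus

open Matrix

section MatrixFunctions

variable {m : Type*} [Fintype m]

theorem continuousOn_dotProduct_mulVec {X : Type*} [TopologicalSpace X] {s : Set X}
    {W : X → Matrix m m ℝ} {x y : X → m → ℝ} (hx : ContinuousOn x s)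
    (hW : ∀ i j, ContinuousOn (fun u => W u i j) s) (hy : ContinuousOn y s) :
    ContinuousOn (fun u => x u ⬝ᵥ W u *ᵥ y u) s := by
  simp only [dotProduct, mulVec]
  exact continuousOn_finsetSum _ fun i _ => (continuousOn_pi.1 hx i).mul
    (continuousOn_finsetSum _ fun j _ => (hW i j).mul (continuousOn_pi.1 hy j))

theorem continuousOn_mul_apply {X : Type*} [TopologicalSpace X] {s : Set X}
    {W U : X → Matrix m m ℝ} (hW : ∀ i j, ContinuousOn (fun u => W u i j) s)
    (hU : ∀ i j, ContinuousOn (fun u => U u i j) s) (i j : m) :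
    ContinuousOn (fun u => (W u * U u) i j) s := by
  simp only [Matrix.mul_apply]
  exact continuousOn_finsetSum _ fun k _ => (hW i k).mul (hU k j)

theorem hasDerivWithinAt_dotProduct_mulVec {W : ℝ → Matrix m m ℝ} {W' : Matrix m m ℝ}
    {x : ℝ → m → ℝ} {x' : m → ℝ} {s : Set ℝ} {t : ℝ} (hx : HasDerivWithinAt x x' s t)
    (hW : ∀ i j, HasDerivWithinAt (fun u => W u i j) (W' i j) s t) (hsymm : (W t).IsSymm) :
    HasDerivWithinAt (fun u => x u ⬝ᵥ W u *ᵥ x u)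
      (x t ⬝ᵥ W' *ᵥ x t + 2 * (x' ⬝ᵥ W t *ᵥ x t)) s t := by
  have hxi := hasDerivWithinAt_pi.1 hx
  have h1 := HasDerivWithinAt.fun_sum (u := Finset.univ) fun i _ => (hxi i).mul
    (HasDerivWithinAt.fun_sum (u := Finset.univ) fun j _ => (hW i j).mul (hxi j))
  refine h1.congr_deriv ?_
  have h2 : x' ⬝ᵥ W t *ᵥ x t = x t ⬝ᵥ W t *ᵥ x' := by
    rw [dotProduct_mulVec_comm_of_isSymm hsymm, dotProduct_comm]
  rw [two_mul]
  nth_rewrite 2 [h2]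
  simp only [dotProduct, mulVec, Finset.sum_add_distrib, mul_add, Pi.mul_apply]
  ring

end MatrixFunctions

namespace ConstrainedSystem
namespace FibredChart

variable {n r : ℕ} {V A : Type*}
  [TopologicalSpace V] [ChartedSpace (EventModel n) V] [IsManifold 𝓘(ℝ, EventModel n) ∞ V]
  [TopologicalSpace A] [ChartedSpace (VelModel n r) A] [IsManifold 𝓘(ℝ, VelModel n r) ∞ A]
  {S : ConstrainedSystem n r V A} {c : S.FibredChart}
  {L : A → ℝ} {t₀ t₁ : ℝ} {g : ℝ → A} {p : ℝ → Fin n → ℝ}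

theorem mem_slab (hg : S.IsAdmissible t₀ t₁ g)
    (hgc : ∀ t ∈ Icc t₀ t₁, g t ∈ c.chartA.source) {t : ℝ} (ht : t ∈ Icc t₀ t₁) :
    (t, c.coord g t) ∈ c.slab t₀ t₁ := ⟨mem_target hg hgc ht, ht⟩

theorem continuousOn_hess (hL : ContMDiff 𝓘(ℝ, VelModel n r) 𝓘(ℝ, ℝ) ∞ L)
    (hg : S.IsAdmissible t₀ t₁ g) (hgc : ∀ t ∈ Icc t₀ t₁, g t ∈ c.chartA.source)
    (hp : c.IsPontryagin L t₀ t₁ g p) {X Y : ℝ → QZ n r}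
    (hX : ContinuousOn X (Icc t₀ t₁)) (hY : ContinuousOn Y (Icc t₀ t₁)) :
    ContinuousOn (fun t => c.hess L t₀ t₁ g p t (X t) (Y t)) (Icc t₀ t₁) := by
  have h1 : ContinuousOn (fun t => c.adaptedLagFDeriv₂ L p t (c.coord g t)) (Icc t₀ t₁) :=
    (continuousOn_adaptedLagFDeriv₂ hL hp).comp (f := fun t => (t, c.coord g t))
      (continuousOn_id.prodMk (continuousOn_coord hg hgc)) fun _ ht => mem_slab hg hgc ht
  exact ((h1.clm_apply hX).clm_apply hY).congr fun t ht => hess_eq hL (mem_target hg hgc ht) _ _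

theorem continuousOn_G_inv (hL : ContMDiff 𝓘(ℝ, VelModel n r) 𝓘(ℝ, ℝ) ∞ L)
    (hg : S.IsAdmissible t₀ t₁ g) (hgc : ∀ t ∈ Icc t₀ t₁, g t ∈ c.chartA.source)
    (hp : c.IsPontryagin L t₀ t₁ g p) (hG : ∀ t ∈ Icc t₀ t₁, (c.G L g p t).PosDef)
    (α β : Fin r) : ContinuousOn (fun t => (c.G L g p t)⁻¹ α β) (Icc t₀ t₁) := by
  refine continuousOn_inv_apply (fun α β => ?_) (fun t h => (hG t h).det_pos.ne') α β
  refine (continuousOn_hess hL hg hgc hp (X := fun _ => dz n α)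
    (Y := fun _ => dz n β) continuousOn_const continuousOn_const).congr fun t h => ?_
  exact (G_apply hL (mem_target hg hgc h) α β).trans (hess_eq hL (mem_target hg hgc h) _ _).symm

theorem continuousOn_hor (hL : ContMDiff 𝓘(ℝ, VelModel n r) 𝓘(ℝ, ℝ) ∞ L)
    (hg : S.IsAdmissible t₀ t₁ g) (hgc : ∀ t ∈ Icc t₀ t₁, g t ∈ c.chartA.source)
    (hp : c.IsPontryagin L t₀ t₁ g p) (hG : ∀ t ∈ Icc t₀ t₁, (c.G L g p t).PosDef) (i : Fin n) :
    ContinuousOn (fun t => c.hor L t₀ t₁ g p t i) (Icc t₀ t₁) := by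
  refine continuousOn_const.prodMk (continuousOn_pi.2 fun α => ContinuousOn.neg
    (continuousOn_finsetSum _ fun β _ => (continuousOn_G_inv hL hg hgc hp hG α β).mul ?_))
  exact continuousOn_hess hL hg hgc hp continuousOn_const continuousOn_const

/-- The matrix `T` with entries `T^i_k = τ_k^i`. -/
def tauMatrix (c : S.FibredChart) (L : A → ℝ) (t₀ t₁ : ℝ) (g : ℝ → A) (p : ℝ → Fin n → ℝ) (t : ℝ) :
    Matrix (Fin n) (Fin n) ℝ := Matrix.of fun i k => c.tau L t₀ t₁ g p t k i

/-- The right-hand side `N + ᵗT W + W T - W M W` of the Riccati equation satisfied by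
`W = E K⁻¹`. -/
def riccatiField (c : S.FibredChart) (L : A → ℝ) (t₀ t₁ : ℝ) (g : ℝ → A) (p : ℝ → Fin n → ℝ)
    (t : ℝ) (W : Matrix (Fin n) (Fin n) ℝ) : Matrix (Fin n) (Fin n) ℝ :=
  c.N L t₀ t₁ g p t + (c.tauMatrix L t₀ t₁ g p t)ᵀ * W + W * c.tauMatrix L t₀ t₁ g p t
    - W * c.M L g p t * W

theorem continuousOn_riccatiField (hL : ContMDiff 𝓘(ℝ, VelModel n r) 𝓘(ℝ, ℝ) ∞ L)
    (hg : S.IsAdmissible t₀ t₁ g) (hgc : ∀ t ∈ Icc t₀ t₁, g t ∈ c.chartA.source)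
    (hp : c.IsPontryagin L t₀ t₁ g p) (hG : ∀ t ∈ Icc t₀ t₁, (c.G L g p t).PosDef)
    {W : ℝ → Matrix (Fin n) (Fin n) ℝ} (hW : ∀ i j, ContinuousOn (fun t => W t i j) (Icc t₀ t₁))
    (i j : Fin n) :
    ContinuousOn (fun t => c.riccatiField L t₀ t₁ g p t (W t) i j) (Icc t₀ t₁) := by
  have hN : ∀ i j, ContinuousOn (fun t => c.N L t₀ t₁ g p t i j) (Icc t₀ t₁) := fun i j =>
    continuousOn_hess hL hg hgc hp (continuousOn_hor hL hg hgc hp hG i)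
      (continuousOn_hor hL hg hgc hp hG j)
  have hT : ∀ i j, ContinuousOn (fun t => c.tauMatrix L t₀ t₁ g p t i j) (Icc t₀ t₁) := fun i j =>
    (continuousOn_pi.1 (continuousOn_dpsi hg hgc (continuousOn_hor hL hg hgc hp hG j)) i).neg
  have hM : ∀ i j, ContinuousOn (fun t => c.M L g p t i j) (Icc t₀ t₁) := by
    intro i j
    simp only [M, Matrix.of_apply]
    exact continuousOn_finsetSum _ fun α _ => continuousOn_finsetSum _ fun β _ =>
      ((continuousOn_G_inv hL hg hgc hp hG α β).mul
        (continuousOn_pi.1 (continuousOn_dpsi hg hgc continuousOn_const) i)).mul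
        (continuousOn_pi.1 (continuousOn_dpsi hg hgc continuousOn_const) j)
  exact (((hN i j).add (continuousOn_mul_apply (fun i j => hT j i) hW i j)).add
    (continuousOn_mul_apply hW hT i j)).sub
    (continuousOn_mul_apply (continuousOn_mul_apply hW hM) hW i j)

/-- `E K⁻¹` satisfies the Riccati equation; the terms `K T` and `E T`, coming from the lower indices
of `K` and `E`, cancel each other. -/
theorem hasDerivWithinAt_riccati {K E : ℝ → Matrix (Fin n) (Fin n) ℝ}
    (hKE : c.IsLinearSolution L t₀ t₁ g p K E) (hdet : ∀ t ∈ Icc t₀ t₁, (K t).det ≠ 0) {t : ℝ}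
    (h : t ∈ Icc t₀ t₁) (i j : Fin n) :
    HasDerivWithinAt (fun s => (E s * (K s)⁻¹) i j)
      (c.riccatiField L t₀ t₁ g p t (E t * (K t)⁻¹) i j) (Icc t₀ t₁) t := by
  set T := c.tauMatrix L t₀ t₁ g p t with hT
  set K' : Matrix (Fin n) (Fin n) ℝ :=
    Matrix.of fun i j => derivWithin (fun s => K s i j) (Icc t₀ t₁) t with hK'
  set E' : Matrix (Fin n) (Fin n) ℝ :=
    Matrix.of fun i j => derivWithin (fun s => E s i j) (Icc t₀ t₁) t with hE'
  have h1 : c.absDerivMixed L t₀ t₁ g p K t = K' + T * K t - K t * T := by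
    ext i j
    simp [absDerivMixed, hK', hT, tauMatrix, Matrix.mul_apply, mul_comm]
  have h2 : c.absDerivCov L t₀ t₁ g p E t = E' - Tᵀ * E t - E t * T := by
    ext i j
    simp [absDerivCov, hE', hT, tauMatrix, Matrix.mul_apply, mul_comm]
  have h3 : K' = c.M L g p t * E t - T * K t + K t * T := by
    rw [← hKE.eq_K t h, h1]; abel
  have h4 : E' = c.N L t₀ t₁ g p t * K t + Tᵀ * E t + E t * T := by
    rw [← hKE.eq_E t h, h2]; abel
  have hu : IsUnit (K t).det := isUnit_iff_ne_zero.2 (hdet t h)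
  refine (hasDerivWithinAt_mul_inv_apply (K' := K') (E' := E')
    (fun i j => (hKE.differentiable_K i j t h).hasDerivWithinAt)
    (fun i j => (hKE.differentiable_E i j t h).hasDerivWithinAt) (hdet t h) i j).congr_deriv ?_
  refine congrFun (congrFun (?_ : (_ : Matrix (Fin n) (Fin n) ℝ) = _) i) j
  have h5 : K t * (K t)⁻¹ = 1 := mul_nonsing_inv _ hu
  have h6 : (K t)⁻¹ * K t = 1 := nonsing_inv_mul _ hu
  have h7 : E' * (K t)⁻¹ = c.N L t₀ t₁ g p t + Tᵀ * (E t * (K t)⁻¹) + E t * T * (K t)⁻¹ := by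
    rw [h4, add_mul, add_mul, mul_assoc, h5, mul_one, mul_assoc Tᵀ]
  have h8 : E t * (K t)⁻¹ * K' * (K t)⁻¹ = E t * (K t)⁻¹ * c.M L g p t * (E t * (K t)⁻¹)
      - E t * (K t)⁻¹ * T + E t * T * (K t)⁻¹ := by
    have h9 : E t * (K t)⁻¹ * (K t * T) = E t * T := by
      rw [mul_assoc, ← mul_assoc _ _ T, h6, one_mul]
    have h10 : E t * (K t)⁻¹ * (T * K t) * (K t)⁻¹ = E t * (K t)⁻¹ * T := by
      rw [mul_assoc, mul_assoc T, h5, mul_one]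
    rw [h3, mul_add, mul_sub, add_mul, sub_mul, h9, h10]
    simp only [mul_assoc]
  rw [h7, h8, riccatiField, ← hT]
  abel

/-- The hessian of the adapted Lagrangian diminished by the total derivative of `W_ij X^i X^j`. -/
def calibratedForm (c : S.FibredChart) (L : A → ℝ) (p : ℝ → Fin n → ℝ)
    (W W' : ℝ → Matrix (Fin n) (Fin n) ℝ) (t : ℝ) (y v : QZ n r) : ℝ :=
  c.adaptedLagFDeriv₂ L p t y v v - v.1 ⬝ᵥ W' t *ᵥ v.1
    - 2 * (fderiv ℝ (c.psi t) y v ⬝ᵥ W t *ᵥ v.1)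

theorem calibratedForm_smul (W W' : ℝ → Matrix (Fin n) (Fin n) ℝ) (t : ℝ) (y v : QZ n r) (a : ℝ) :
    c.calibratedForm L p W W' t y (a • v) = a ^ 2 * c.calibratedForm L p W W' t y v := by
  simp only [calibratedForm, map_smul, _root_.smul_apply, Prod.smul_fst, mulVec_smul,
    dotProduct_smul, smul_dotProduct, smul_eq_mul]
  ring

/-- Some symmetric tensor `W` along the curve makes the calibrated form strictly positive. It is
obtained from the solution `W₀ = E K⁻¹` of the Riccati equation, for which the form is only
nonnegative, as `W₀ - exp (k (t - t₁))` with `k` large. -/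
theorem exists_pos_calibratedForm (hL : ContMDiff 𝓘(ℝ, VelModel n r) 𝓘(ℝ, ℝ) ∞ L)
    (hg : S.IsAdmissible t₀ t₁ g) (hgc : ∀ t ∈ Icc t₀ t₁, g t ∈ c.chartA.source)
    (hp : c.IsPontryagin L t₀ t₁ g p) (hG : ∀ t ∈ Icc t₀ t₁, (c.G L g p t).PosDef)
    {K E : ℝ → Matrix (Fin n) (Fin n) ℝ} (hKE : c.IsLinearSolution L t₀ t₁ g p K E)
    (hsymm : ∀ t ∈ Icc t₀ t₁, (E t * (K t)⁻¹).IsSymm)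
    (hdet : ∀ t ∈ Icc t₀ t₁, (K t).det ≠ 0) :
    ∃ W W' : ℝ → Matrix (Fin n) (Fin n) ℝ, (∀ t ∈ Icc t₀ t₁, (W t).IsSymm) ∧
      (∀ t ∈ Icc t₀ t₁, ∀ i j,
        HasDerivWithinAt (fun s => W s i j) (W' t i j) (Icc t₀ t₁) t) ∧
      (∀ i j, ContinuousOn (fun t => W' t i j) (Icc t₀ t₁)) ∧
      ∀ t ∈ Icc t₀ t₁, ∀ v ≠ 0, 0 < c.calibratedForm L p W W' t (c.coord g t) v := by
  set W₀ : ℝ → Matrix (Fin n) (Fin n) ℝ := fun t => E t * (K t)⁻¹ with hW₀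
  set W₀' : ℝ → Matrix (Fin n) (Fin n) ℝ := fun t => c.riccatiField L t₀ t₁ g p t (W₀ t) with hW₀'
  have hd : ∀ t ∈ Icc t₀ t₁, ∀ i j,
      HasDerivWithinAt (fun s => W₀ s i j) (W₀' t i j) (Icc t₀ t₁) t := fun t h i j =>
    hasDerivWithinAt_riccati hKE hdet h i j
  have hc₀ : ∀ i j, ContinuousOn (fun t => W₀ t i j) (Icc t₀ t₁) := fun i j t h =>
    (hd t h i j).continuousWithinAt
  have hc : ∀ i j, ContinuousOn (fun t => W₀' t i j) (Icc t₀ t₁) :=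
    continuousOn_riccatiField hL hg hgc hp hG hc₀
  -- the square completed with `W₀`
  have hsq : ∀ t ∈ Icc t₀ t₁, ∀ v : QZ n r, ∃ Z : Fin r → ℝ,
      c.calibratedForm L p W₀ W₀' t (c.coord g t) v = Z ⬝ᵥ c.G L g p t *ᵥ Z ∧
        (v.1 = 0 → Z = v.2) := by
    intro t h v
    have hm := mem_target hg hgc h
    refine sub_riccati_eq_dotProduct (c.adaptedLagFDeriv₂ L p t (c.coord g t))
      (adaptedLagFDeriv₂_symm hL hm) (fderiv ℝ (c.psi t) (c.coord g t)) (G_apply hL hm)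
      (isUnit_iff_ne_zero.2 (hG t h).det_pos.ne') (h := c.control L t₀ t₁ g p t)
      (N := c.N L t₀ t₁ g p t) (M := c.M L g p t) (T := c.tauMatrix L t₀ t₁ g p t)
      (fun i α => ?_) (fun i j => ?_) (fun i j => rfl) (fun i k => rfl) (hsymm t h) rfl v
    · simp only [control, hess_eq hL hm]
    · exact hess_eq hL hm _ _
  have hnonneg : ∀ t ∈ Icc t₀ t₁, ∀ v : QZ n r,
      0 ≤ c.calibratedForm L p W₀ W₀' t (c.coord g t) v := by
    intro t h v
    obtain ⟨Z, hZ, -⟩ := hsq t h v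
    rw [hZ]
    simpa using (hG t h).posSemidef.dotProduct_mulVec_nonneg Z
  have hpos : ∀ t ∈ Icc t₀ t₁, ∀ v : QZ n r, v ≠ 0 → v.1 = 0 →
      0 < c.calibratedForm L p W₀ W₀' t (c.coord g t) v := by
    intro t h v hv hv1
    obtain ⟨Z, hZ, hZ0⟩ := hsq t h v
    rw [hZ, hZ0 hv1]
    have : v.2 ≠ 0 := fun h2 => hv (Prod.ext hv1 h2)
    simpa using (hG t h).dotProduct_mulVec_pos this
  have hcf : ContinuousOn (fun x : ℝ × QZ n r =>
      c.calibratedForm L p W₀ W₀' x.1 (c.coord g x.1) x.2 + 2 * (x.2.1 ⬝ᵥ c.dpsi g x.1 x.2))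
      (Icc t₀ t₁ ×ˢ Metric.sphere 0 1) := by
    have hfst : ∀ {F : Type} [TopologicalSpace F] {f : ℝ → F}, ContinuousOn f (Icc t₀ t₁) →
        ContinuousOn (fun x : ℝ × QZ n r => f x.1) (Icc t₀ t₁ ×ˢ Metric.sphere 0 1) :=
      fun hf => hf.comp continuous_fst.continuousOn fun _ hx => hx.1
    have hs : ContinuousOn (fun x : ℝ × QZ n r => x.2) (Icc t₀ t₁ ×ˢ Metric.sphere 0 1) :=
      continuous_snd.continuousOn
    have hs1 : ContinuousOn (fun x : ℝ × QZ n r => x.2.1) (Icc t₀ t₁ ×ˢ Metric.sphere 0 1) :=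
      (continuous_fst.comp continuous_snd).continuousOn
    have h1 : ContinuousOn (fun t => c.adaptedLagFDeriv₂ L p t (c.coord g t)) (Icc t₀ t₁) :=
      (continuousOn_adaptedLagFDeriv₂ hL hp).comp (f := fun t => (t, c.coord g t))
        (continuousOn_id.prodMk (continuousOn_coord hg hgc)) fun _ ht => mem_slab hg hgc ht
    have h2 : ContinuousOn (fun t => fderiv ℝ (c.psi t) (c.coord g t)) (Icc t₀ t₁) :=
      continuousOn_along continuousOn_fderiv_psi hg hgc
    have h3 := (hfst h2).clm_apply hs
    refine (((((hfst h1).clm_apply hs).clm_apply hs).sub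
      (continuousOn_dotProduct_mulVec hs1 (fun i j => hfst (hc i j)) hs1)).sub
      (continuousOn_const.mul
        (continuousOn_dotProduct_mulVec h3 (fun i j => hfst (hc₀ i j)) hs1))).add
      (continuousOn_const.mul (continuousOn_finsetSum _ fun i _ =>
        (continuousOn_pi.1 hs1 i).mul (continuousOn_pi.1 h3 i)))
  obtain ⟨k, hk, hkpos⟩ := exists_pos_add_mul (isCompact_Icc.prod (isCompact_sphere 0 1)) hcf
    (g := fun x => x.2.1 ⬝ᵥ x.2.1) (continuousOn_finsetSum _ fun i _ => by fun_prop)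
    (fun x _ => by simpa using dotProduct_self_star_nonneg x.2.1) (by
      rintro ⟨t, v⟩ ⟨h, hv⟩ h0
      have hv1 : v.1 = 0 := dotProduct_self_eq_zero.1 h0
      have hv0 : v ≠ 0 := Metric.ne_of_mem_sphere hv one_ne_zero
      simpa [hv1] using hpos t h v hv0 hv1)
  have hkpos' : ∀ t ∈ Icc t₀ t₁, ∀ v : QZ n r, v ≠ 0 →
      0 < c.calibratedForm L p W₀ W₀' t (c.coord g t) v + 2 * (v.1 ⬝ᵥ c.dpsi g t v)
        + k * (v.1 ⬝ᵥ v.1) := by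
    intro t h v hv
    have hn : ‖v‖ ≠ 0 := norm_ne_zero_iff.2 hv
    have h1 := hkpos (t, ‖v‖⁻¹ • v) ⟨h, by simp [norm_smul, hn]⟩
    simp only [calibratedForm_smul, dpsi, map_smul, Prod.smul_fst, smul_dotProduct,
      dotProduct_smul, smul_eq_mul] at h1
    have h2 : 0 < ‖v‖⁻¹ ^ 2 := by positivity
    refine (mul_pos_iff_of_pos_left h2).1 ?_
    simp only [dpsi]
    linarith
  set s : ℝ → ℝ := fun t => Real.exp (k * (t - t₁)) with hs
  have hsd : ∀ t, HasDerivAt s (k * s t) t := by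
    intro t
    have h1 := (((hasDerivAt_id t).sub_const t₁).const_mul k).exp
    refine h1.congr_deriv ?_
    simp [hs, mul_comm]
  refine ⟨fun t => W₀ t - s t • 1, fun t => W₀' t - (k * s t) • 1, fun t h => ?_,
    fun t h i j => ?_, fun i j => ?_, fun t h v hv => ?_⟩
  · exact (hsymm t h).sub (Matrix.isSymm_one.smul _)
  · exact (hd t h i j).sub ((hsd t).hasDerivWithinAt.mul_const _)
  · refine (hc i j).sub (ContinuousOn.mul (Continuous.continuousOn ?_) continuousOn_const)
    simp only [hs]
    fun_prop
  · have hs0 : 0 < s t := Real.exp_pos _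
    have hs1 : s t ≤ 1 := Real.exp_le_one_iff.2
      (mul_nonpos_of_nonneg_of_nonpos hk (sub_nonpos.2 h.2))
    have h1 := hkpos' t h v hv
    have h2 := hnonneg t h v
    have h3 : c.calibratedForm L p (fun t => W₀ t - s t • 1) (fun t => W₀' t - (k * s t) • 1) t
        (c.coord g t) v = c.calibratedForm L p W₀ W₀' t (c.coord g t) v
          + s t * (2 * (v.1 ⬝ᵥ c.dpsi g t v) + k * (v.1 ⬝ᵥ v.1)) := by
      simp only [calibratedForm, dpsi, sub_mulVec, smul_mulVec, one_mulVec, dotProduct_sub,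
        dotProduct_smul, smul_eq_mul, dotProduct_comm v.1 (fderiv ℝ (c.psi t) (c.coord g t) v)]
      ring
    rw [h3]
    nlinarith [mul_nonneg (sub_nonneg.2 hs1) h2, mul_pos hs0 h1]

end FibredChart
end ConstrainedSystem
end ConstrainedCalculus

/-! ### The second variation and the weak minimum -/

namespace ConstrainedCalculus

open Matrix

/-- A function on `[0, 1]` vanishing at `0` together with its derivative is nonnegative at `1` if
its second derivative is nonnegative. -/
theorem nonneg_of_deriv₂_nonneg {f f' f'' : ℝ → ℝ}
    (hf : ∀ s ∈ Icc (0 : ℝ) 1, HasDerivAt f (f' s) s)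
    (hf' : ∀ s ∈ Icc (0 : ℝ) 1, HasDerivAt f' (f'' s) s) (h0 : f 0 = 0) (h0' : f' 0 = 0)
    (hnonneg : ∀ s ∈ Icc (0 : ℝ) 1, 0 ≤ f'' s) : 0 ≤ f 1 := by
  have key : ∀ {f f' : ℝ → ℝ}, (∀ s ∈ Icc (0 : ℝ) 1, HasDerivAt f (f' s) s) → f 0 = 0 →
      (∀ s ∈ Icc (0 : ℝ) 1, 0 ≤ f' s) → ∀ s ∈ Icc (0 : ℝ) 1, 0 ≤ f s := by
    intro f f' hf h0 hn s hs
    have hm := monotoneOn_of_hasDerivWithinAt_nonneg (convex_Icc (0 : ℝ) 1)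
      (fun s hs => (hf s hs).continuousAt.continuousWithinAt)
      (fun s hs => (hf s (interior_subset hs)).hasDerivWithinAt)
      (fun s hs => hn s (interior_subset hs))
    rw [← h0]
    exact hm (left_mem_Icc.2 zero_le_one) hs hs.1
  exact key hf h0 (key hf' h0' hnonneg) 1 (right_mem_Icc.2 zero_le_one)

namespace ConstrainedSystem
namespace FibredChart

variable {n r : ℕ} {V A : Type*}
  [TopologicalSpace V] [ChartedSpace (EventModel n) V] [IsManifold 𝓘(ℝ, EventModel n) ∞ V]
  [TopologicalSpace A] [ChartedSpace (VelModel n r) A] [IsManifold 𝓘(ℝ, VelModel n r) ∞ A]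
  {S : ConstrainedSystem n r V A} {c : S.FibredChart}
  {L : A → ℝ} {t₀ t₁ : ℝ} {g : ℝ → A} {p : ℝ → Fin n → ℝ}

theorem integral_total_derivative_eq_zero (ht : t₀ < t₁)
    {W W' : ℝ → Matrix (Fin n) (Fin n) ℝ} (hW : ∀ t ∈ Icc t₀ t₁, (W t).IsSymm)
    (hd : ∀ t ∈ Icc t₀ t₁, ∀ i j,
      HasDerivWithinAt (fun s => W s i j) (W' t i j) (Icc t₀ t₁) t)
    (hc : ∀ i j, ContinuousOn (fun t => W' t i j) (Icc t₀ t₁)) {x x' : ℝ → Fin n → ℝ}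
    (hx : ∀ t ∈ Icc t₀ t₁, HasDerivWithinAt x (x' t) (Icc t₀ t₁) t)
    (hx' : ContinuousOn x' (Icc t₀ t₁)) (h₀ : x t₀ = 0) (h₁ : x t₁ = 0) :
    ContinuousOn (fun t => x t ⬝ᵥ W' t *ᵥ x t + 2 * (x' t ⬝ᵥ W t *ᵥ x t)) (Icc t₀ t₁) ∧
    ∫ t in t₀..t₁, (x t ⬝ᵥ W' t *ᵥ x t + 2 * (x' t ⬝ᵥ W t *ᵥ x t)) = 0 := by
  have hcx : ContinuousOn x (Icc t₀ t₁) := fun t h => (hx t h).continuousWithinAt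
  have hcW : ∀ i j, ContinuousOn (fun t => W t i j) (Icc t₀ t₁) := fun i j t h =>
    (hd t h i j).continuousWithinAt
  have hcont := (continuousOn_dotProduct_mulVec hcx hc hcx).add
    (continuousOn_const.mul (continuousOn_dotProduct_mulVec hx' hcW hcx) (f := fun _ => (2 : ℝ)))
  refine ⟨hcont, ?_⟩
  rw [integral_eq_sub_of_hasDerivWithinAt_Icc ht.le (fun t h =>
    hasDerivWithinAt_dotProduct_mulVec (hx t h) (hd t h) (hW t h)) hcont, h₀, h₁]
  simp

/-- The second variation is the integral of the calibrated form, since the total derivative of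
`W_ij X^i X^j` integrates to zero. -/
theorem secondVariation_pos (hL : ContMDiff 𝓘(ℝ, VelModel n r) 𝓘(ℝ, ℝ) ∞ L) (ht : t₀ < t₁)
    (hg : S.IsAdmissible t₀ t₁ g) (hgc : ∀ t ∈ Icc t₀ t₁, g t ∈ c.chartA.source)
    (hp : c.IsPontryagin L t₀ t₁ g p)
    {W W' : ℝ → Matrix (Fin n) (Fin n) ℝ} (hW : ∀ t ∈ Icc t₀ t₁, (W t).IsSymm)
    (hd : ∀ t ∈ Icc t₀ t₁, ∀ i j,
      HasDerivWithinAt (fun s => W s i j) (W' t i j) (Icc t₀ t₁) t)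
    (hc : ∀ i j, ContinuousOn (fun t => W' t i j) (Icc t₀ t₁))
    (hpos : ∀ t ∈ Icc t₀ t₁, ∀ v ≠ 0, 0 < c.calibratedForm L p W W' t (c.coord g t) v)
    {X : ℝ → QZ n r} (hX : c.IsInfinitesimalDeformation t₀ t₁ g X)
    (hne : ∃ t ∈ Icc t₀ t₁, X t ≠ 0) : 0 < c.secondVariation L t₀ t₁ g p X := by
  have hI : ∀ f : ℝ → ℝ, ContinuousOn f (Icc t₀ t₁) →
      IntervalIntegrable f MeasureTheory.volume t₀ t₁ := fun f hf =>
    ContinuousOn.intervalIntegrable (by rwa [uIcc_of_le ht.le])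
  obtain ⟨hc1, h1⟩ := integral_total_derivative_eq_zero ht hW hd hc hX.variational
    (continuousOn_dpsi hg hgc hX.continuousOn) hX.left hX.right
  have hc2 := continuousOn_hess hL hg hgc hp hX.continuousOn hX.continuousOn
  have h2 := intervalIntegral.integral_sub (hI _ hc2) (hI _ hc1)
  rw [h1, sub_zero] at h2
  rw [secondVariation, ← h2]
  have h3 : ∀ t ∈ Icc t₀ t₁, c.hess L t₀ t₁ g p t (X t) (X t) -
      ((X t).1 ⬝ᵥ W' t *ᵥ (X t).1 + 2 * (c.dpsi g t (X t) ⬝ᵥ W t *ᵥ (X t).1)) =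
      c.calibratedForm L p W W' t (c.coord g t) (X t) := by
    intro t h
    rw [hess_eq hL (mem_target hg hgc h), calibratedForm, dpsi]
    ring
  refine intervalIntegral.integral_pos ht (hc2.sub hc1) (fun t h => ?_) ?_
  · have h := Ioc_subset_Icc_self h
    rw [h3 t h]
    rcases eq_or_ne (X t) 0 with h0 | h0
    · simp [h0, calibratedForm]
    · exact (hpos t h _ h0).le
  · obtain ⟨t, h, h0⟩ := hne
    exact ⟨t, h, by rw [h3 t h]; exact hpos t h _ h0⟩

/-- The positivity of the calibrated form persists at points near the curve, uniformly in time and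
also when a multiple of the second derivative of `ψ` is added. -/
theorem exists_uniform_pos (hL : ContMDiff 𝓘(ℝ, VelModel n r) 𝓘(ℝ, ℝ) ∞ L)
    (hg : S.IsAdmissible t₀ t₁ g) (hgc : ∀ t ∈ Icc t₀ t₁, g t ∈ c.chartA.source)
    (hp : c.IsPontryagin L t₀ t₁ g p)
    {W W' : ℝ → Matrix (Fin n) (Fin n) ℝ}
    (hcW : ∀ i j, ContinuousOn (fun t => W t i j) (Icc t₀ t₁))
    (hc : ∀ i j, ContinuousOn (fun t => W' t i j) (Icc t₀ t₁))
    (hpos : ∀ t ∈ Icc t₀ t₁, ∀ v ≠ 0, 0 < c.calibratedForm L p W W' t (c.coord g t) v) :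
    ∃ η > 0, ∀ t ∈ Icc t₀ t₁, ∀ e : QZ n r, ∀ w : Fin n → ℝ, ‖e‖ < η → ‖w‖ < η →
      ∀ v : QZ n r, v ≠ 0 → (t, c.coord g t + e) ∈ c.chartA.target ∧
        0 < c.calibratedForm L p W W' t (c.coord g t + e) v
        - fderiv ℝ (fun y' => fderiv ℝ (c.psi t) y') (c.coord g t + e) v v ⬝ᵥ W t *ᵥ w := by
  set Q : (QZ n r × (Fin n → ℝ)) → ℝ × QZ n r → ℝ := fun a x =>
    c.calibratedForm L p W W' x.1 (c.coord g x.1 + a.1) x.2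
      - fderiv ℝ (fun y' => fderiv ℝ (c.psi x.1) y') (c.coord g x.1 + a.1) x.2 x.2
        ⬝ᵥ W x.1 *ᵥ a.2 with hQ
  set s₀ : Set ((QZ n r × (Fin n → ℝ)) × (ℝ × QZ n r)) := {z | z.2.1 ∈ Icc t₀ t₁} with hs₀
  set Φ : (QZ n r × (Fin n → ℝ)) × (ℝ × QZ n r) → ℝ × QZ n r :=
    fun z => (z.2.1, c.coord g z.2.1 + z.1.1) with hΦ
  have hΦc : ContinuousOn Φ s₀ := by
    refine (by fun_prop : Continuous _).continuousOn.prodMk (ContinuousOn.add ?_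
      (by fun_prop : Continuous _).continuousOn)
    exact (continuousOn_coord hg hgc).comp (by fun_prop : Continuous _).continuousOn fun z hz => hz
  set s₁ := s₀ ∩ Φ ⁻¹' c.chartA.target with hs₁
  have hΦs : MapsTo Φ s₁ (c.slab t₀ t₁) := fun z hz => ⟨hz.2, hz.1⟩
  have hΦt : MapsTo Φ s₁ c.chartA.target := fun z hz => hz.2
  have hQc : ContinuousOn (Function.uncurry Q) s₁ := by
    have hΦc1 := hΦc.mono (inter_subset_left : s₁ ⊆ s₀)
    have ht : ∀ {F : Type} [TopologicalSpace F] {f : ℝ → F}, ContinuousOn f (Icc t₀ t₁) →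
        ContinuousOn (fun z : (QZ n r × (Fin n → ℝ)) × (ℝ × QZ n r) => f z.2.1) s₁ :=
      fun hf => hf.comp (by fun_prop : Continuous _).continuousOn fun z hz => hz.1
    have hv : ContinuousOn (fun z : (QZ n r × (Fin n → ℝ)) × (ℝ × QZ n r) => z.2.2) s₁ :=
      (by fun_prop : Continuous _).continuousOn
    have hv1 : ContinuousOn (fun z : (QZ n r × (Fin n → ℝ)) × (ℝ × QZ n r) => z.2.2.1) s₁ :=
      (by fun_prop : Continuous _).continuousOn
    have hw : ContinuousOn (fun z : (QZ n r × (Fin n → ℝ)) × (ℝ × QZ n r) => z.1.2) s₁ :=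
      (by fun_prop : Continuous _).continuousOn
    have h1 := (continuousOn_adaptedLagFDeriv₂ hL hp).comp hΦc1 hΦs
    have h2 := (continuousOn_fderiv_psi (c := c)).comp hΦc1 hΦt
    have h3 := (continuousOn_fderiv₂_psi (c := c)).comp hΦc1 hΦt
    exact ((((h1.clm_apply hv).clm_apply hv).sub
      (continuousOn_dotProduct_mulVec hv1 (fun i j => ht (hc i j)) hv1)).sub
      (continuousOn_const.mul (continuousOn_dotProduct_mulVec (h2.clm_apply hv)
        (fun i j => ht (hcW i j)) hv1))).sub
      (continuousOn_dotProduct_mulVec ((h3.clm_apply hv).clm_apply hv)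
        (fun i j => ht (hcW i j)) hw)
  have hev := (isCompact_Icc.prod
    (isCompact_sphere (0 : QZ n r) 1)).eventually_forall_of_forall_eventually
    (x₀ := (0 : QZ n r × (Fin n → ℝ))) (K := Icc t₀ t₁ ×ˢ Metric.sphere (0 : QZ n r) 1)
    (P := fun a x => (a, x) ∈ s₀ → (a, x) ∈ s₁ ∧ 0 < Q a x) (by
      rintro ⟨t, v⟩ ⟨h, hv⟩
      have h0 : ((0, (t, v)) : (QZ n r × (Fin n → ℝ)) × (ℝ × QZ n r)) ∈ s₀ := h
      have h1 : ((0, (t, v)) : (QZ n r × (Fin n → ℝ)) × (ℝ × QZ n r)) ∈ s₁ :=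
        ⟨h0, by simpa [hΦ] using mem_target hg hgc h⟩
      have h2 : ∀ᶠ z in 𝓝[s₀] (0, (t, v)), z ∈ s₁ :=
        Filter.inter_mem self_mem_nhdsWithin
          ((hΦc _ h0).preimage_mem_nhdsWithin (c.chartA.open_target.mem_nhds h1.2))
      have h3 : ∀ᶠ z in 𝓝[s₁] (0, (t, v)), 0 < Function.uncurry Q z := by
        refine (hQc _ h1).eventually (lt_mem_nhds ?_)
        have := hpos t h v (Metric.ne_of_mem_sphere hv one_ne_zero)
        simpa [hQ] using this
      have h4 : 𝓝[s₁] (0, (t, v)) = 𝓝[s₀] ((0, (t, v)) : (QZ n r × (Fin n → ℝ)) × (ℝ × QZ n r)) :=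
        le_antisymm (nhdsWithin_mono _ inter_subset_left) (nhdsWithin_le_of_mem h2)
      rw [h4] at h3
      exact eventually_nhdsWithin_iff.1 (h2.and h3))
  obtain ⟨η, hη, hball⟩ := Metric.eventually_nhds_iff.1 hev
  refine ⟨η, hη, fun t h e w he hw v hv => ?_⟩
  have hn : ‖v‖ ≠ 0 := norm_ne_zero_iff.2 hv
  have hd : dist (e, w) (0 : QZ n r × (Fin n → ℝ)) < η := by
    rw [dist_zero_right, Prod.norm_def]
    exact max_lt he hw
  obtain ⟨h1, h2⟩ := hball hd (t, ‖v‖⁻¹ • v) ⟨h, by simp [norm_smul, hn]⟩ h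
  refine ⟨h1.2, ?_⟩
  simp only [hQ, calibratedForm_smul, map_smul, _root_.smul_apply, smul_dotProduct,
    smul_eq_mul] at h2
  have h3 : 0 < ‖v‖⁻¹ ^ 2 := by positivity
  refine (mul_pos_iff_of_pos_left h3).1 ?_
  linarith

/-- Near the curve the adapted Lagrangian dominates half the total derivative of `W_ij x^i x^j`,
where `x` is the difference of the coordinates `q`: the difference of the two is convex along the
segment issuing from the point of the curve, where it vanishes to first order. -/
theorem half_total_derivative_le_adaptedLag (hL : ContMDiff 𝓘(ℝ, VelModel n r) 𝓘(ℝ, ℝ) ∞ L)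
    (ht : t₀ < t₁) (hg : S.IsAdmissible t₀ t₁ g) (hgc : ∀ t ∈ Icc t₀ t₁, g t ∈ c.chartA.source)
    (hp : c.IsPontryagin L t₀ t₁ g p) {W W' : ℝ → Matrix (Fin n) (Fin n) ℝ} {t : ℝ}
    (h : t ∈ Icc t₀ t₁) {η : ℝ}
    (hη : ∀ e : QZ n r, ∀ w : Fin n → ℝ, ‖e‖ < η → ‖w‖ < η →
      ∀ v : QZ n r, v ≠ 0 → (t, c.coord g t + e) ∈ c.chartA.target ∧
      0 < c.calibratedForm L p W W' t (c.coord g t + e) v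
        - fderiv ℝ (fun y' => fderiv ℝ (c.psi t) y') (c.coord g t + e) v v ⬝ᵥ W t *ᵥ w)
    {v : QZ n r} (hv : ‖v‖ < η) :
    (1 / 2 : ℝ) * (v.1 ⬝ᵥ W' t *ᵥ v.1 + 2 *
      ((c.psi t (c.coord g t + v) - c.psi t (c.coord g t)) ⬝ᵥ W t *ᵥ v.1)) ≤
      c.adaptedLag L t₀ t₁ g p t (c.coord g t + v) := by
  rcases eq_or_ne v 0 with rfl | hv0
  · simp [adaptedLag_coord hg hgc ht h]
  set y := c.coord g t with hy
  have hsmall : ∀ s ∈ Icc (0 : ℝ) 1, (t, y + s • v) ∈ c.chartA.target ∧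
      0 < c.calibratedForm L p W W' t (y + s • v) v
        - fderiv ℝ (fun y' => fderiv ℝ (c.psi t) y') (y + s • v) v v ⬝ᵥ W t *ᵥ (s • v.1) := by
    intro s hs
    have h1 : ‖s • v‖ ≤ ‖v‖ := by
      rw [norm_smul, Real.norm_of_nonneg hs.1]
      exact mul_le_of_le_one_left (norm_nonneg _) hs.2
    exact hη (s • v) (s • v.1) (h1.trans_lt hv)
      (((norm_fst_le (s • v)).trans h1).trans_lt hv) v hv0
  have hline : ∀ s : ℝ, HasDerivAt (fun s : ℝ => y + s • v) v s := fun s => by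
    simpa using ((hasDerivAt_id s).smul_const v).const_add y
  have hpsi : ∀ s ∈ Icc (0 : ℝ) 1, HasDerivAt (fun s : ℝ => c.psi t (y + s • v))
      (fderiv ℝ (c.psi t) (y + s • v) v) s := fun s hs =>
    hasDerivAt_comp_curve (differentiableAt_slice c.chartA.open_target c.contDiffOn_psi
      (hsmall s hs).1).hasFDerivAt (hline s)
  have hpsi' : ∀ s ∈ Icc (0 : ℝ) 1, HasDerivAt (fun s : ℝ => fderiv ℝ (c.psi t) (y + s • v) v)
      (fderiv ℝ (fun y' => fderiv ℝ (c.psi t) y') (y + s • v) v v) s := by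
    intro s hs
    have h1 := hasDerivAt_clm_apply_curve (differentiableAt_slice c.chartA.open_target
      (contDiffOn_fderiv_slice c.chartA.open_target c.contDiffOn_psi) (hsmall s hs).1).hasFDerivAt
      (hline s) (hasDerivAt_const s v)
    simpa using h1
  have hdot : ∀ {f : ℝ → Fin n → ℝ} {f' : Fin n → ℝ} {s : ℝ} (u : Fin n → ℝ), HasDerivAt f f' s →
      HasDerivAt (fun s => f s ⬝ᵥ u) (f' ⬝ᵥ u) s := by
    intro f f' s u hf
    exact HasDerivAt.fun_sum fun i _ => (hasDerivAt_pi.1 hf i).mul_const (u i)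
  set u := W t *ᵥ v.1 with hu
  set k := v.1 ⬝ᵥ W' t *ᵥ v.1 with hk
  have key := nonneg_of_deriv₂_nonneg
    (f := fun s => c.adaptedLag L t₀ t₁ g p t (y + s • v) - (s ^ 2 / 2 * k +
      s * ((c.psi t (y + s • v) - c.psi t y) ⬝ᵥ u)))
    (f' := fun s => c.adaptedLagFDeriv L t₀ t₁ p t (y + s • v) v - (s * k +
      ((c.psi t (y + s • v) - c.psi t y) ⬝ᵥ u + s * (fderiv ℝ (c.psi t) (y + s • v) v ⬝ᵥ u))))
    (f'' := fun s => c.adaptedLagFDeriv₂ L p t (y + s • v) v v - (k +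
      (fderiv ℝ (c.psi t) (y + s • v) v ⬝ᵥ u + (fderiv ℝ (c.psi t) (y + s • v) v ⬝ᵥ u +
        s * (fderiv ℝ (fun y' => fderiv ℝ (c.psi t) y') (y + s • v) v v ⬝ᵥ u)))))
    (fun s hs => ?_) (fun s hs => ?_) ?_ ?_ (fun s hs => ?_)
  · simp only [one_smul, one_pow, one_mul] at key
    linarith
  · have h1 := hasDerivAt_comp_curve (hasFDerivAt_adaptedLag (t₀ := t₀) (t₁ := t₁) (g := g)
      (p := p) hL (hsmall s hs).1) (hline s)
    have h2 : HasDerivAt (fun s : ℝ => s ^ 2 / 2 * k) (s * k) s := by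
      refine (((hasDerivAt_pow 2 s).div_const 2).mul_const k).congr_deriv ?_
      simp
    have h3 := (hasDerivAt_id s).mul (hdot u ((hpsi s hs).sub_const (c.psi t y)))
    refine (h1.sub (h2.add h3)).congr_deriv ?_
    simp
  · have h1 := hasDerivAt_clm_apply_curve (hasFDerivAt_adaptedLagFDeriv (t₀ := t₀) (t₁ := t₁)
      (p := p) hL (hsmall s hs).1) (hline s) (hasDerivAt_const s v)
    have h2 : HasDerivAt (fun s : ℝ => s * k) k s := by
      simpa using (hasDerivAt_id s).mul_const k
    have h3 := hdot u ((hpsi s hs).sub_const (c.psi t y))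
    have h4 := (hasDerivAt_id s).mul (hdot u (hpsi' s hs))
    refine (h1.sub (h2.add (h3.add h4))).congr_deriv ?_
    simp
  · simp [hy, adaptedLag_coord hg hgc ht h]
  · simp [hy, adaptedLagFDeriv_coord hp ht h]
  · have h1 := (hsmall s hs).2
    rw [calibratedForm, mulVec_smul, dotProduct_smul, smul_eq_mul] at h1
    linarith

theorem coord_fst_eq {g' : ℝ → A} {t : ℝ} (h : g t ∈ c.chartA.source) (h' : g' t ∈ c.chartA.source)
    (he : S.proj (g' t) = S.proj (g t)) : (c.coord g' t).1 = (c.coord g t).1 := by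
  rw [coord, coord, c.chartA_pos _ h, c.chartA_pos _ h', he]

/-- A calibration with positive definite form makes the curve a weak local minimum; the
neighbourhood of its first jet contains the velocities of just those points of `A` whose coordinates
are uniformly close to those of the curve at the same time. -/
theorem isWeakLocalMin_of_calibratedForm_pos (hL : ContMDiff 𝓘(ℝ, VelModel n r) 𝓘(ℝ, ℝ) ∞ L)
    (ht : t₀ < t₁) (hg : S.IsAdmissible t₀ t₁ g) (hgc : ∀ t ∈ Icc t₀ t₁, g t ∈ c.chartA.source)
    (hp : c.IsPontryagin L t₀ t₁ g p)
    {W W' : ℝ → Matrix (Fin n) (Fin n) ℝ} (hW : ∀ t ∈ Icc t₀ t₁, (W t).IsSymm)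
    (hd : ∀ t ∈ Icc t₀ t₁, ∀ i j,
      HasDerivWithinAt (fun s => W s i j) (W' t i j) (Icc t₀ t₁) t)
    (hc : ∀ i j, ContinuousOn (fun t => W' t i j) (Icc t₀ t₁))
    (hpos : ∀ t ∈ Icc t₀ t₁, ∀ v ≠ 0, 0 < c.calibratedForm L p W W' t (c.coord g t) v) :
    S.IsWeakLocalMin L t₀ t₁ g := by
  refine ⟨hg, ?_⟩
  obtain ⟨η, hη, hball⟩ := exists_uniform_pos hL hg hgc hp
    (fun i j t h => (hd t h i j).continuousWithinAt) hc hpos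
  -- the coordinates of the curve are extended by constants outside `[t₀, t₁]`, so that the
  -- neighbourhood is open in `A`
  have hext : Continuous fun t => c.coord g (projIcc t₀ t₁ ht.le t) :=
    (continuousOn_coord hg hgc).comp_continuous (continuous_subtype_val.comp continuous_projIcc)
      fun t => (projIcc t₀ t₁ ht.le t).2
  have hU₀ : IsOpen {x : VelModel n r | ‖x.2 - c.coord g (projIcc t₀ t₁ ht.le x.1)‖ < η} :=
    isOpen_lt ((continuous_snd.sub (hext.comp continuous_fst)).norm) continuous_const
  have hU := c.chartA.isOpen_inter_preimage hU₀
  obtain ⟨O, hO, hOU⟩ := S.embedding.isEmbedding.isInducing.isOpen_iff.1 hU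
  have hmem : ∀ a, S.jet a ∈ O ↔ a ∈ c.chartA.source ∧
      ‖(c.chartA a).2 - c.coord g (projIcc t₀ t₁ ht.le (c.chartA a).1)‖ < η := fun a =>
    Set.ext_iff.1 hOU a
  refine ⟨O, hO, fun t h => (hmem _).2 ⟨hgc t h, ?_⟩, fun g' hg' h₀ h₁ hg'O => ?_⟩
  · rw [chartA_apply hg hgc h]
    simpa [projIcc_of_mem ht.le h] using hη
  have hgc' : ∀ t ∈ Icc t₀ t₁, g' t ∈ c.chartA.source := fun t h => ((hmem _).1 (hg'O t h)).1
  have hclose : ∀ t ∈ Icc t₀ t₁, ‖c.coord g' t - c.coord g t‖ < η := by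
    intro t h
    have h1 := ((hmem _).1 (hg'O t h)).2
    rw [chartA_apply hg' hgc' h] at h1
    simpa [projIcc_of_mem ht.le h] using h1
  have hl : t₀ ∈ Icc t₀ t₁ := left_mem_Icc.2 ht.le
  have hr : t₁ ∈ Icc t₀ t₁ := right_mem_Icc.2 ht.le
  have he₀ := coord_fst_eq (hgc _ hl) (hgc' _ hl) h₀
  have he₁ := coord_fst_eq (hgc _ hr) (hgc' _ hr) h₁
  obtain ⟨hc1, h1⟩ := integral_total_derivative_eq_zero ht hW hd hc
    (x := fun t => (c.coord g' t - c.coord g t).1)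
    (fun t h => (hasDerivWithinAt_coord_fst hg' hgc' h).sub (hasDerivWithinAt_coord_fst hg hgc h))
    ((continuousOn_along continuousOn_psi hg' hgc').sub
      (continuousOn_along continuousOn_psi hg hgc)) (sub_eq_zero.2 he₀) (sub_eq_zero.2 he₁)
  have hc2 : ContinuousOn (fun t => c.adaptedLag L t₀ t₁ g p t (c.coord g' t)) (Icc t₀ t₁) :=
    (continuousOn_adaptedLag hL hg hgc hp ht).comp (f := fun t => (t, c.coord g' t))
      (continuousOn_id.prodMk (continuousOn_coord hg' hgc')) fun _ h => mem_slab hg' hgc' h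
  rw [action_sub_action hL hg hgc hp ht hg' hgc' he₀ he₁]
  rw [← uIcc_of_le ht.le] at hc1 hc2
  have h2 := intervalIntegral.integral_mono_on (μ := MeasureTheory.volume) ht.le
    (hc1.intervalIntegrable.const_mul (1 / 2 : ℝ))
    hc2.intervalIntegrable (fun t h => by
      have h3 := half_total_derivative_le_adaptedLag hL ht hg hgc hp h (hball t h) (hclose t h)
      rwa [add_sub_cancel] at h3)
  rw [intervalIntegral.integral_const_mul, h1, mul_zero] at h2
  linarith

/-- The vector field tangent to a deformation with fixed end-points is an admissible infinitesimal
deformation. -/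
theorem IsDeformation.isInfinitesimalDeformation {ε : ℝ} {Γ : ℝ → ℝ → A} {y₁ y₂ : ℝ → ℝ → QZ n r}
    (hΓ : c.IsDeformation t₀ t₁ g ε Γ y₁ y₂) (ht : t₀ < t₁) (hg : S.IsAdmissible t₀ t₁ g)
    (hgc : ∀ t ∈ Icc t₀ t₁, g t ∈ c.chartA.source) :
    c.IsInfinitesimalDeformation t₀ t₁ g (y₁ 0) := by
  have h0 : (0 : ℝ) ∈ Ioo (-ε) ε := ⟨neg_lt_zero.2 hΓ.pos, hΓ.pos⟩
  have hl : t₀ ∈ Icc t₀ t₁ := left_mem_Icc.2 ht.le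
  have hr : t₁ ∈ Icc t₀ t₁ := right_mem_Icc.2 ht.le
  have hcoord0 : ∀ t ∈ Icc t₀ t₁, c.coord (Γ 0) t = c.coord g t := fun t h => by
    rw [coord, coord, hΓ.zero t h]
  have hcont : ∀ ξ ∈ Ioo (-ε) ε, ContinuousOn (c.coord (Γ ξ)) (Icc t₀ t₁) := fun ξ hξ =>
    continuousOn_coord (hΓ.admissible ξ hξ) (hΓ.mem_source ξ hξ)
  have hjoint := continuousOn_uncurry_of_hasDerivAt hcont hΓ.hasDeriv hΓ.continuousOn₁
  have hc0 : ContinuousOn (y₁ 0) (Icc t₀ t₁) :=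
    hΓ.continuousOn₁.comp (f := fun t => ((0 : ℝ), t)) (by fun_prop) fun t h => ⟨h0, h⟩
  have hend : ∀ t ∈ Icc t₀ t₁, (∀ ξ ∈ Ioo (-ε) ε, S.proj (Γ ξ t) = S.proj (g t)) →
      (y₁ 0 t).1 = 0 := by
    intro t h he
    have h1 : HasDerivAt (fun η => (c.coord (Γ η) t).1) (y₁ 0 t).1 0 :=
      hasDerivAt_comp_curve hasFDerivAt_fst (hΓ.hasDeriv 0 h0 t h)
    refine h1.unique ((hasDerivAt_const (0 : ℝ) (c.coord g t).1).congr_of_eventuallyEq ?_)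
    filter_upwards [isOpen_Ioo.mem_nhds h0] with ξ hξ
    exact coord_fst_eq (hgc t h) (hΓ.mem_source ξ hξ t h) (he ξ hξ)
  -- the variational equation is the derivative at `ξ = 0` of the integrated admissibility equation
  have hint : ∀ t ∈ Icc t₀ t₁, (y₁ 0 t).1 = ∫ s in t₀..t, c.dpsi g s (y₁ 0 s) := by
    intro t h
    have hsub : Icc t₀ t ⊆ Icc t₀ t₁ := Icc_subset_Icc_right h.2
    have hpsi : ∀ ξ ∈ Ioo (-ε) ε, ContinuousOn (fun s => c.psi s (c.coord (Γ ξ) s)) (Icc t₀ t₁) :=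
      fun ξ hξ => continuousOn_along continuousOn_psi (hΓ.admissible ξ hξ) (hΓ.mem_source ξ hξ)
    have h1 := hasDerivAt_integral_of_continuousOn (ε := ε) h.1
      (f := fun ξ s => c.psi s (c.coord (Γ ξ) s))
      (f' := fun ξ s => fderiv ℝ (c.psi s) (c.coord (Γ ξ) s) (y₁ ξ s))
      (fun ξ hξ => (hpsi ξ hξ).mono hsub)
      (fun ξ hξ s hs => hasDerivAt_comp_curve (differentiableAt_slice c.chartA.open_target
        c.contDiffOn_psi (mem_target (hΓ.admissible ξ hξ) (hΓ.mem_source ξ hξ)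
          (hsub hs))).hasFDerivAt (hΓ.hasDeriv ξ hξ s (hsub hs)))
      ((((continuousOn_fderiv_psi (c := c)).comp (f := fun x : ℝ × ℝ => (x.2, c.coord (Γ x.1) x.2))
        (continuous_snd.continuousOn.prodMk hjoint) fun x hx =>
          mem_target (hΓ.admissible _ hx.1) (hΓ.mem_source _ hx.1) hx.2).clm_apply
        hΓ.continuousOn₁).mono (prod_mono subset_rfl hsub)) h0
    have h2 : HasDerivAt (fun η => (c.coord (Γ η) t).1) (y₁ 0 t).1 0 :=
      hasDerivAt_comp_curve hasFDerivAt_fst (hΓ.hasDeriv 0 h0 t h)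
    have h3 : (∫ s in t₀..t, c.dpsi g s (y₁ 0 s)) =
        ∫ s in t₀..t, fderiv ℝ (c.psi s) (c.coord (Γ 0) s) (y₁ 0 s) := by
      refine intervalIntegral.integral_congr fun s hs => ?_
      rw [uIcc_of_le h.1] at hs
      simp only [dpsi, hcoord0 s (hsub hs)]
    rw [h3]
    refine h2.unique ((h1.const_add (c.coord g t₀).1).congr_of_eventuallyEq ?_)
    filter_upwards [isOpen_Ioo.mem_nhds h0] with ξ hξ
    rw [integral_eq_sub_of_hasDerivWithinAt_Icc h.1 (fun s hs => (hasDerivWithinAt_coord_fst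
      (hΓ.admissible ξ hξ) (hΓ.mem_source ξ hξ) (hsub hs)).mono hsub) ((hpsi ξ hξ).mono hsub),
      coord_fst_eq (hgc _ hl) (hΓ.mem_source ξ hξ _ hl) (hΓ.left ξ hξ), add_sub_cancel]
  have hcd := continuousOn_dpsi hg hgc hc0
  refine ⟨hc0, fun t h => ?_, hend t₀ hl hΓ.left, hend t₁ hr hΓ.right⟩
  have : Fact (t ∈ Icc t₀ t₁) := ⟨h⟩
  refine HasDerivWithinAt.congr (f := fun u => ∫ s in t₀..u, c.dpsi g s (y₁ 0 s)) ?_ hint (hint t h)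
  have hsub : Icc t₀ t ⊆ Icc t₀ t₁ := Icc_subset_Icc_right h.2
  refine intervalIntegral.integral_hasDerivWithinAt_right (t := Icc t₀ t₁)
    (ContinuousOn.intervalIntegrable (by rw [uIcc_of_le h.1]; exact hcd.mono hsub))
    (hcd.stronglyMeasurableAtFilter_nhdsWithin measurableSet_Icc t) (hcd t h)

/-- The first and second derivatives of the action along a deformation, from differentiating twice
the integral of the adapted Lagrangian. -/
theorem IsDeformation.action_derivatives {ε : ℝ} {Γ : ℝ → ℝ → A} {y₁ y₂ : ℝ → ℝ → QZ n r}
    (hL : ContMDiff 𝓘(ℝ, VelModel n r) 𝓘(ℝ, ℝ) ∞ L)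
    (hΓ : c.IsDeformation t₀ t₁ g ε Γ y₁ y₂) (ht : t₀ < t₁) (hg : S.IsAdmissible t₀ t₁ g)
    (hgc : ∀ t ∈ Icc t₀ t₁, g t ∈ c.chartA.source) (hp : c.IsPontryagin L t₀ t₁ g p) :
    (∀ᶠ ξ in 𝓝 0, DifferentiableAt ℝ (fun η => action L t₀ t₁ (Γ η)) ξ) ∧
      HasDerivAt (deriv fun ξ => action L t₀ t₁ (Γ ξ))
        (c.secondVariation L t₀ t₁ g p (y₁ 0)) 0 := by
  have h0 : (0 : ℝ) ∈ Ioo (-ε) ε := ⟨neg_lt_zero.2 hΓ.pos, hΓ.pos⟩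
  have hl : t₀ ∈ Icc t₀ t₁ := left_mem_Icc.2 ht.le
  have hr : t₁ ∈ Icc t₀ t₁ := right_mem_Icc.2 ht.le
  have hcoord0 : ∀ t ∈ Icc t₀ t₁, c.coord (Γ 0) t = c.coord g t := fun t h => by
    rw [coord, coord, hΓ.zero t h]
  have hjoint := continuousOn_uncurry_of_hasDerivAt (fun ξ hξ =>
    continuousOn_coord (hΓ.admissible ξ hξ) (hΓ.mem_source ξ hξ)) hΓ.hasDeriv hΓ.continuousOn₁
  have hpt : ContinuousOn (fun x : ℝ × ℝ => (x.2, c.coord (Γ x.1) x.2))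
      (Ioo (-ε) ε ×ˢ Icc t₀ t₁) := continuous_snd.continuousOn.prodMk hjoint
  have hpm : MapsTo (fun x : ℝ × ℝ => (x.2, c.coord (Γ x.1) x.2)) (Ioo (-ε) ε ×ˢ Icc t₀ t₁)
      (c.slab t₀ t₁) := fun x hx => mem_slab (hΓ.admissible _ hx.1) (hΓ.mem_source _ hx.1) hx.2
  have hrow : ∀ {F : Type} [TopologicalSpace F] {f : ℝ × ℝ → F},
      ContinuousOn f (Ioo (-ε) ε ×ˢ Icc t₀ t₁) → ∀ ξ ∈ Ioo (-ε) ε,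
      ContinuousOn (fun t => f (ξ, t)) (Icc t₀ t₁) := fun hf ξ hξ =>
    hf.comp (f := fun t => (ξ, t)) (by fun_prop) fun t h => ⟨hξ, h⟩
  have hF0 := (continuousOn_adaptedLag hL hg hgc hp ht).comp hpt hpm
  have hF1 := ((continuousOn_adaptedLagFDeriv hL hg hgc hp ht).comp hpt hpm).clm_apply
    hΓ.continuousOn₁
  have hF2 := ((((continuousOn_adaptedLagFDeriv₂ hL hp).comp hpt hpm).clm_apply
    hΓ.continuousOn₁).clm_apply hΓ.continuousOn₁).add
    (((continuousOn_adaptedLagFDeriv hL hg hgc hp ht).comp hpt hpm).clm_apply hΓ.continuousOn₂)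
  have hd1 : ∀ ξ ∈ Ioo (-ε) ε, HasDerivAt (fun η => action L t₀ t₁ (Γ η))
      (∫ t in t₀..t₁, c.adaptedLagFDeriv L t₀ t₁ p t (c.coord (Γ ξ) t) (y₁ ξ t)) ξ := by
    intro ξ hξ
    have h1 := hasDerivAt_integral_of_continuousOn (ε := ε) ht.le
      (f := fun ξ t => c.adaptedLag L t₀ t₁ g p t (c.coord (Γ ξ) t))
      (f' := fun ξ t => c.adaptedLagFDeriv L t₀ t₁ p t (c.coord (Γ ξ) t) (y₁ ξ t))
      (hrow hF0) (fun ξ hξ t h => hasDerivAt_comp_curve (hasFDerivAt_adaptedLag hL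
        (hpm (x := (ξ, t)) ⟨hξ, h⟩).1) (hΓ.hasDeriv ξ hξ t h)) hF1 hξ
    refine (h1.const_add (action L t₀ t₁ g)).congr_of_eventuallyEq ?_
    filter_upwards [isOpen_Ioo.mem_nhds hξ] with η hη
    exact action_sub_action hL hg hgc hp ht (hΓ.admissible η hη) (hΓ.mem_source η hη)
      (coord_fst_eq (hgc _ hl) (hΓ.mem_source η hη _ hl) (hΓ.left η hη))
      (coord_fst_eq (hgc _ hr) (hΓ.mem_source η hη _ hr) (hΓ.right η hη))
  have hd2 := hasDerivAt_integral_of_continuousOn (ε := ε) ht.le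
    (f := fun ξ t => c.adaptedLagFDeriv L t₀ t₁ p t (c.coord (Γ ξ) t) (y₁ ξ t))
    (f' := fun ξ t => c.adaptedLagFDeriv₂ L p t (c.coord (Γ ξ) t) (y₁ ξ t) (y₁ ξ t) +
      c.adaptedLagFDeriv L t₀ t₁ p t (c.coord (Γ ξ) t) (y₂ ξ t))
    (hrow hF1) (fun ξ hξ t h => hasDerivAt_clm_apply_curve (hasFDerivAt_adaptedLagFDeriv hL
      (hpm (x := (ξ, t)) ⟨hξ, h⟩).1) (hΓ.hasDeriv ξ hξ t h) (hΓ.hasDeriv₂ ξ hξ t h)) hF2 h0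
  refine ⟨?_, ?_⟩
  · filter_upwards [isOpen_Ioo.mem_nhds h0] with ξ hξ using (hd1 ξ hξ).differentiableAt
  · have h1 : c.secondVariation L t₀ t₁ g p (y₁ 0) =
        ∫ t in t₀..t₁, (c.adaptedLagFDeriv₂ L p t (c.coord (Γ 0) t) (y₁ 0 t) (y₁ 0 t) +
          c.adaptedLagFDeriv L t₀ t₁ p t (c.coord (Γ 0) t) (y₂ 0 t)) := by
      refine intervalIntegral.integral_congr fun t h => ?_
      rw [uIcc_of_le ht.le] at h
      -- the second derivative of the coordinates does not contribute, as `ℒ'` is critical along `g`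
      simp only [hcoord0 t h, adaptedLagFDeriv_coord hp ht h, hess_eq hL (mem_target hg hgc h),
        _root_.zero_apply, add_zero]
    rw [h1]
    refine hd2.congr_of_eventuallyEq ?_
    filter_upwards [isOpen_Ioo.mem_nhds h0] with ξ hξ using (hd1 ξ hξ).deriv

end FibredChart
end ConstrainedSystem
end ConstrainedCalculus

end

open ConstrainedCalculus ConstrainedCalculus.ConstrainedSystem in
theorem theorem3p3 {n r : ℕ} {V A : Type*}
    [TopologicalSpace V] [ChartedSpace (EventModel n) V] [IsManifold 𝓘(ℝ, EventModel n) ∞ V]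
    [TopologicalSpace A] [ChartedSpace (VelModel n r) A] [IsManifold 𝓘(ℝ, VelModel n r) ∞ A]
    (S : ConstrainedSystem n r V A)
    (L : A → ℝ) (hL : ContMDiff 𝓘(ℝ, VelModel n r) 𝓘(ℝ, ℝ) ∞ L)
    (t₀ t₁ : ℝ) (ht : t₀ < t₁)
    -- the section `γ = proj ∘ g`, with lift `g` contained in the domain of a fibred chart
    (g : ℝ → A) (hg : S.IsAdmissible t₀ t₁ g)
    (c : S.FibredChart) (hgc : ∀ t ∈ Icc t₀ t₁, g t ∈ c.chartA.source)
    -- `γ` is a normal extremal, and `p` are its momenta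
    (p : ℝ → Fin n → ℝ) (hp : c.IsPontryagin L t₀ t₁ g p) (hnormal : c.IsNormal t₀ t₁ g)
    (hG : ∀ t ∈ Icc t₀ t₁, (c.G L g p t).PosDef)
    (K E : ℝ → Matrix (Fin n) (Fin n) ℝ) (hKE : c.IsLinearSolution L t₀ t₁ g p K E)
    (hsymm : ∀ t ∈ Icc t₀ t₁, (E t * (K t)⁻¹).IsSymm)
    (hdet : ∀ t ∈ Icc t₀ t₁, (K t).det ≠ 0) :
    -- positivity on the non-zero admissible infinitesimal deformations with fixed end-points
    (∀ X : ℝ → QZ n r, c.IsInfinitesimalDeformation t₀ t₁ g X → (∃ t ∈ Icc t₀ t₁, X t ≠ 0) →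
      0 < c.secondVariation L t₀ t₁ g p X) ∧
    -- the second derivative of the action along any deformation of `γ`, and its positivity
    (∀ (ε : ℝ) (Γ : ℝ → ℝ → A) (y₁ y₂ : ℝ → ℝ → QZ n r),
      c.IsDeformation t₀ t₁ g ε Γ y₁ y₂ →
        (∀ᶠ ξ in 𝓝 0, DifferentiableAt ℝ (fun η => action L t₀ t₁ (Γ η)) ξ) ∧
        HasDerivAt (deriv fun ξ => action L t₀ t₁ (Γ ξ))
          (c.secondVariation L t₀ t₁ g p (y₁ 0)) 0 ∧
        ((∃ t ∈ Icc t₀ t₁, y₁ 0 t ≠ 0) → 0 < c.secondVariation L t₀ t₁ g p (y₁ 0))) ∧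
    -- `γ` yields a weak local minimum
    S.IsWeakLocalMin L t₀ t₁ g := by
  obtain ⟨W, W', hW, hd, hc, hpos⟩ :=
    FibredChart.exists_pos_calibratedForm hL hg hgc hp hG hKE hsymm hdet
  have hpos₂ := fun X hX =>
    FibredChart.secondVariation_pos (X := X) hL ht hg hgc hp hW hd hc hpos hX
  refine ⟨hpos₂, fun ε Γ y₁ y₂ hΓ => ?_,
    FibredChart.isWeakLocalMin_of_calibratedForm_pos hL ht hg hgc hp hW hd hc hpos⟩
  obtain ⟨h1, h2⟩ := FibredChart.IsDeformation.action_derivatives hL hΓ ht hg hgc hp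
  exact ⟨h1, h2, hpos₂ _ (hΓ.isInfinitesimalDeformation ht hg hgc)⟩
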